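/- \textbf{Setting.} A cluster has $N=3f+1$ processes $p_0,\dots,p_{3f}$, at most $f$ of them Byzantine; the others are correct. Byzantine processes send arbitrary messages in their own names, but cannot forge signatures or messages of correct processes. The network is partially synchronous: links are authenticated and perfect, and a message sent at time $s$ between correct processes arrives by time $\max(s,\mathrm{GST})+\delta$, where $\delta>0$ and $\mathrm{GST}$ is an arbitrary global stabilization time. Local computation takes no time. A message whose handler has a guard is buffered until the guard holds; "broadcast" sends to all processes, including oneself. The timer under leader timestamp $t$ has period $\Delta(t)>0$ (for instance constant or increasing), and $\Delta(t)>6\delta$ for all sufficiently large $t$. \textbf{Byzantine Reliable Dissemination (BRD).} Every process keeps a current leader with timestamp $\mathit{ts}$, initially an arbitrary process (possibly Byzantine) with $\mathit{ts}=0$, and a timer, running from the start with period $\Delta(0)$. (1) On request $\mathit{broadcast}(m)$ (at most one per process) it stores $m$, sends the signed $\langle m,\mathit{ts}\rangle$ to the leader and resets its timer. (2) The leader collects the senders, messages and signatures of the messages $\langle m,\mathit{ts}\rangle$ of its current timestamp, and the messages $\mathit{Valid}(M,\Sigma,t)$ that it consumes while it is the leader and whose $\Sigma$ holds $2f+1$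 signatures of $\mathit{Echo}(M,t)$ or $f+1$ of $\mathit{Ready}(M,t)$, keeping a set $M$ of largest $t$. When it has heard from $2f+1$ processes, it broadcasts, once per timestamp, $\mathit{Agg}(M,\Sigma,\mathit{ts})$, with the kept valid set and its certificate if there is one, and otherwise with the collected messages and signatures. (3) On the first $\mathit{Agg}(M,\Sigma,\mathit{ts})$ from the leader in which $\Sigma$ attests $M$ ($M$ is the set of messages signed in $\Sigma$ for $\mathit{ts}$, with at least $2f+1$ signers; or, for some timestamp $u$, $\Sigma$ holds $2f+1$ signatures of $\mathit{Echo}(M,u)$ or $f+1$ of $\mathit{Ready}(M,u)$), a process broadcasts the signed $\mathit{Echo}(M,\mathit{ts})$. (4) On $2f+1$ messages $\mathit{Echo}(M,\mathit{ts})$ or $f+1$ messages $\mathit{Ready}(M,\mathit{ts})$ from distinct processes, it broadcasts the signed $\mathit{Ready}(M,\mathit{ts})$, once per timestamp, and stores $M$ with these signatures and $\mathit{ts}$ as its valid set. (5) On $2f+1$ messages $\mathit{Ready}(M,\mathit{ts})$ from distinct processes, it delivers $M$, unless it has delivered before, and stops its timer. (6) When the timer expires, it complains to leader election. (7) On $\mathit{new\text{-}leader}(p,t)$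 it sets its leader to $p$ and $\mathit{ts}=t$, clears the state of the old timestamp except the valid set, the broadcast message and the fact that it delivered, resets its timer, and sends to $p$ its valid set, if there is one, and otherwise $\langle m,t\rangle$ for the message $m$ that it broadcast, if any. \textbf{Leader election.} Every process has an election timestamp, initially $1$. A complaint makes it broadcast $\mathit{Complaint}(t)$ for its election timestamp $t$, once per timestamp; $f+1$ messages $\mathit{Complaint}(t)$ from distinct processes make it do the same; after $2f+1$ of them it moves to timestamp $t+1$ and issues $\mathit{new\text{-}leader}(p_{(t+1)\bmod N},t+1)$ to BRD. \textbf{Lemma (Termination).} In every infinite execution (with time unbounded) of BRD composed with this leader election, if every correct process broadcasts a message, then every correct process eventually delivers a set of messages, whichever processes are Byzantine, the initial leader included. -/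

import Mathlib

/-!
Byzantine Reliable Dissemination (BRD) in one cluster of `3 f + 1` processes, composed with the
complaint-based leader election, over authenticated perfect links in a partially synchronous network.
An event `upon deliver(..) where G` whose guard `G` is false when the message arrives stays buffered
until `G` holds.
-/

namespace BRD

/-- The processes `p_0, ..., p_{3 f}` of the cluster. -/
abbrev Proc (f : ℕ) : Type := Fin (3 * f + 1)

/-- The protocol messages whose signatures are used in certificates:
`⟨m, t⟩`, `Echo(M, t)` and `Ready(M, t)`. -/
inductive Stmt (V : Type*) where
  | contrib (m : V) (t : ℕ)
  | echo (M : Finset V) (t : ℕ)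
  | ready (M : Finset V) (t : ℕ)

/-- A signature: the signing process together with what it signed. -/
abbrev Sig (f : ℕ) (V : Type*) := Proc f × Stmt V

/-- Messages on the links: a signed statement (the signature is that of the sender),
`Agg(M, Σ, t)`, `Valid(M, Σ, t)`, and the leader election message `Complaint(t)`. -/
inductive Msg (f : ℕ) (V : Type*) where
  | signed (x : Stmt V)
  | agg (M : Finset V) (sigs : Finset (Sig f V)) (t : ℕ)
  | valid (M : Finset V) (sigs : Finset (Sig f V)) (t : ℕ)
  | complaint (t : ℕ)

/-- The signatures of certificates carried inside a message. -/
def Msg.carried {f : ℕ} {V : Type*} : Msg f V → Finset (Sig f V)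
  | .signed _ => ∅
  | .agg _ sigs _ => sigs
  | .valid _ sigs _ => sigs
  | .complaint _ => ∅

/-- A message in transit. `id` is the number of the step that sent it; it distinguishes
equal messages that are sent at different moments. -/
structure Packet (f : ℕ) (V : Type*) where
  id : ℕ
  src : Proc f
  dst : Proc f
  msg : Msg f V

/-- What a handler sends: destinations with messages. -/
abbrev Out (f : ℕ) (V : Type*) := Set (Proc f × Msg f V)

/-- Best-effort broadcast: the message goes to every process, the sender included. -/
def toAll {f : ℕ} {V : Type*} (x : Msg f V) : Out f V := {o | o.2 = x}

open Classical in
/-- The number of distinct processes whose signature of `x` is in `sigs`. -/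
noncomputable def sigCount {f : ℕ} {V : Type*} (sigs : Finset (Sig f V)) (x : Stmt V) : ℕ :=
  (Finset.univ.filter fun p : Proc f => (p, x) ∈ sigs).card

/-- `sigs` holds `2 f + 1` signatures of `Echo(M, t)` or `f + 1` signatures of `Ready(M, t)`. -/
def VoteCert {f : ℕ} {V : Type*} (M : Finset V) (sigs : Finset (Sig f V)) (t : ℕ) : Prop :=
  2 * f + 1 ≤ sigCount sigs (.echo M t) ∨ f + 1 ≤ sigCount sigs (.ready M t)

open Classical in
/-- `M` is the set of the messages signed in `sigs` for timestamp `t`, and at least `2 f + 1`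
processes signed one. -/
def CollectCert {f : ℕ} {V : Type*} (M : Finset V) (sigs : Finset (Sig f V)) (t : ℕ) : Prop :=
  2 * f + 1 ≤ (Finset.univ.filter fun p : Proc f => ∃ m, (p, Stmt.contrib m t) ∈ sigs).card ∧
    ∀ m, m ∈ M ↔ ∃ p : Proc f, (p, Stmt.contrib m t) ∈ sigs

/-- The check on `Agg(M, Σ, t)`: `Σ` attests `M`, either by collected messages of the current
timestamp, or by the votes of some timestamp (for an adopted set, an earlier one). -/
def Attests {f : ℕ} {V : Type*} (M : Finset V) (sigs : Finset (Sig f V)) (t : ℕ) : Prop :=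
  CollectCert M sigs t ∨ ∃ u, VoteCert M sigs u

/-- The local state of a process: BRD variables, leader election variables, and link buffers. -/
structure LState (f : ℕ) (V : Type*) where
  leader : Proc f
  ts : ℕ
  /-- the message the process broadcast, if any -/
  myM : Option V
  echoed : Prop
  readied : Prop
  delivered : Prop
  valid : Option (Finset V × Finset (Sig f V) × ℕ)
  highValid : Option (Finset V × Finset (Sig f V) × ℕ)
  /-- as leader: senders, messages and signatures collected for the current timestamp -/
  q : Finset (Proc f)
  M : Finset V
  sigs : Finset (Sig f V)
  /-- as leader: whether the aggregation was broadcast for the current timestamp -/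
  proposed : Prop
  /-- when the timer expires; `none` if it is stopped or has expired -/
  deadline : Option ℝ
  /-- the response `deliver(M, Σ)` with certificate `Σ'`, once it is issued -/
  output : Option (Finset V × Finset (Sig f V) × Finset (Sig f V))
  /-- leader election: timestamp, complaining processes, whether the process complained -/
  leTs : ℕ
  leC : Finset (Proc f)
  leComplained : Prop
  /-- packets delivered by the links, and those of them consumed by a handler -/
  received : Set (Packet f V)
  handled : Set (Packet f V)

/-- The state at time `0`. `timeout t` is the period of the timer under timestamp `t`. -/
def LState.init {f : ℕ} (V : Type*) (timeout : ℕ → ℝ) (p₀ : Proc f) : LState f V where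
  leader := p₀
  ts := 0
  myM := none
  echoed := False
  readied := False
  delivered := False
  valid := none
  highValid := none
  q := ∅
  M := ∅
  sigs := ∅
  proposed := False
  deadline := some (timeout 0)
  output := none
  leTs := 1
  leC := ∅
  leComplained := False
  received := ∅
  handled := ∅

namespace LState

variable {f : ℕ} {V : Type*}

open Classical in
/-- The processes from which the statement `x` was received. -/
noncomputable def senders (s : LState f V) (x : Stmt V) : Finset (Proc f) :=
  Finset.univ.filter fun p => ∃ k ∈ s.received, k.src = p ∧ k.msg = .signed x

/-- The signatures of `x` that were received. -/
noncomputable def cert (s : LState f V) (x : Stmt V) : Finset (Sig f V) :=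
  s.senders x ×ˢ {x}

/-- The packet `k` was received and is not consumed yet. -/
def Pending (s : LState f V) (k : Packet f V) : Prop := k ∈ s.received ∧ k ∉ s.handled

/-- Consume the packet `k`. -/
def consume (s : LState f V) (k : Packet f V) : LState f V :=
  { s with handled := insert k s.handled }

open Classical in
/-- The leader adds a message `m` of `p` to its collection. -/
noncomputable def collect (s : LState f V) (p : Proc f) (m : V) : LState f V :=
  { s with
    q := insert p s.q
    M := insert m s.M
    sigs := insert (p, Stmt.contrib m s.ts) s.sigs }

open Classical in
/-- The leader handles an attested valid set of `p`, keeping the one of largest timestamp. -/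
noncomputable def collectValid (s : LState f V) (p : Proc f) (v : Finset V × Finset (Sig f V) × ℕ) :
    LState f V :=
  { s with
    q := insert p s.q
    highValid :=
      match s.highValid with
      | none => some v
      | some w => if w.2.2 < v.2.2 then some v else some w }

/-- The aggregation that the leader broadcasts: the adopted valid set if there is one, and
otherwise the collected messages. -/
def proposal (s : LState f V) : Msg f V :=
  match s.highValid with
  | none => .agg s.M s.sigs s.ts
  | some v => .agg v.1 v.2.1 s.ts

/-- The BRD request `new-leader(p, t)` at time `now`: the new state. -/
def newLeader (timeout : ℕ → ℝ) (now : ℝ) (s : LState f V) (p : Proc f) (t : ℕ) : LState f V :=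
  { s with
    leader := p
    ts := t
    echoed := False
    readied := False
    highValid := none
    q := ∅
    M := ∅
    sigs := ∅
    proposed := False
    deadline := some (now + timeout t) }

/-- The BRD request `new-leader(p, t)`: what is sent to the new leader. -/
def newLeaderOut (s : LState f V) (p : Proc f) (t : ℕ) : Out f V :=
  match s.valid with
  | some v => {(p, .valid v.1 v.2.1 v.2.2)}
  | none =>
    match s.myM with
    | some m => {(p, .signed (.contrib m t))}
    | none => ∅

open Classical in
/-- The leader election request `complain`: broadcast a complaint unless this was done already. -/
noncomputable def complain (s : LState f V) : LState f V × Out f V :=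
  if s.leComplained then (s, ∅) else ({ s with leComplained := True }, toAll (.complaint s.leTs))

/-- Leader election moves to the next leader in round-robin order, `p_{ts mod (3 f + 1)}`,
and passes it to BRD. -/
def change (timeout : ℕ → ℝ) (now : ℝ) (s : LState f V) : LState f V × Out f V :=
  let t := s.leTs + 1
  let p : Proc f := Fin.ofNat (3 * f + 1) t
  (newLeader timeout now { s with leTs := t, leC := ∅, leComplained := False } p t,
    s.newLeaderOut p t)

open Classical in
/-- Leader election handles a complaint of `p` for its current timestamp: amplify after `f + 1`
complaints, change the leader after `2 f + 1`. -/
noncomputable def onComplaint (timeout : ℕ → ℝ) (now : ℝ) (s : LState f V) (p : Proc f) :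
    LState f V × Out f V :=
  let s₁ : LState f V := { s with leC := insert p s.leC }
  let r₂ : LState f V × Out f V := if f + 1 ≤ s₁.leC.card then s₁.complain else (s₁, ∅)
  if 2 * f + 1 ≤ s₁.leC.card then
    ((change timeout now r₂.1).1, r₂.2 ∪ (change timeout now r₂.1).2)
  else r₂

end LState

/-- The events at a correct process. -/
inductive Event (f : ℕ) (V : Type*) where
  /-- request `broadcast(m)` -/
  | broadcast (m : V)
  /-- the link hands over a packet -/
  | receive (k : Packet f V)
  /-- the leader handles `⟨m, t⟩` -/
  | contribution (k : Packet f V)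
  /-- the leader handles `Valid(M, Σ, t)` -/
  | validSet (k : Packet f V)
  /-- the leader has messages from a quorum and broadcasts the aggregation -/
  | propose
  /-- an attested aggregation of the leader is accepted and echoed -/
  | aggregation (k : Packet f V)
  /-- a quorum of `Echo(M, ts)` -/
  | echoQuorum (M : Finset V)
  /-- `f + 1` messages `Ready(M, ts)` -/
  | readyAmplify (M : Finset V)
  /-- a quorum of `Ready(M, ts)`: response `deliver` -/
  | deliver (M : Finset V)
  /-- the timer expires: response `complain(leader)`, passed to leader election -/
  | timeout
  /-- leader election handles `Complaint(t)` -/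
  | complaint (k : Packet f V)

/-- `LocalStep timeout now p s e s' o`: at time `now` the correct process `p` in state `s` can execute
the event `e`, which leads to the state `s'` and sends `o`. -/
inductive LocalStep {f : ℕ} {V : Type*} (timeout : ℕ → ℝ) (now : ℝ) (p : Proc f) (s : LState f V) :
    Event f V → LState f V → Out f V → Prop where
  | broadcast (m : V) (h : s.myM = none) :
      LocalStep timeout now p s (.broadcast m)
        { s with myM := some m, deadline := some (now + timeout s.ts) }
        {(s.leader, .signed (.contrib m s.ts))}
  | receive (k : Packet f V) (hdst : k.dst = p) (hnew : k ∉ s.received) :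
      LocalStep timeout now p s (.receive k) { s with received := insert k s.received } ∅
  | contribution (k : Packet f V) (m : V) (hk : s.Pending k)
      (hmsg : k.msg = .signed (.contrib m s.ts)) (hlead : p = s.leader) :
      LocalStep timeout now p s (.contribution k) ((s.consume k).collect k.src m) ∅
  | validSet (k : Packet f V) (M : Finset V) (sigs : Finset (Sig f V)) (t : ℕ) (hk : s.Pending k)
      (hmsg : k.msg = .valid M sigs t) (hlead : p = s.leader) (hatt : VoteCert M sigs t) :
      LocalStep timeout now p s (.validSet k) ((s.consume k).collectValid k.src (M, sigs, t)) ∅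
  | propose (hq : 2 * f + 1 ≤ s.q.card) (hnew : ¬ s.proposed) :
      LocalStep timeout now p s .propose { s with proposed := True } (toAll s.proposal)
  | aggregation (k : Packet f V) (M : Finset V) (sigs : Finset (Sig f V)) (hk : s.Pending k)
      (hmsg : k.msg = .agg M sigs s.ts) (hsrc : k.src = s.leader) (hnew : ¬ s.echoed)
      (hatt : Attests M sigs s.ts) :
      LocalStep timeout now p s (.aggregation k) { s.consume k with echoed := True }
        (toAll (.signed (.echo M s.ts)))
  | echoQuorum (M : Finset V) (hq : 2 * f + 1 ≤ (s.senders (.echo M s.ts)).card)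
      (hnew : ¬ s.readied) :
      LocalStep timeout now p s (.echoQuorum M)
        { s with readied := True, valid := some (M, s.cert (.echo M s.ts), s.ts) }
        (toAll (.signed (.ready M s.ts)))
  | readyAmplify (M : Finset V) (hq : f + 1 ≤ (s.senders (.ready M s.ts)).card)
      (hnew : ¬ s.readied) :
      LocalStep timeout now p s (.readyAmplify M)
        { s with readied := True, valid := some (M, s.cert (.ready M s.ts), s.ts) }
        (toAll (.signed (.ready M s.ts)))
  | deliver (M : Finset V) (hq : 2 * f + 1 ≤ (s.senders (.ready M s.ts)).card)
      (hnew : ¬ s.delivered) :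
      LocalStep timeout now p s (.deliver M)
        { s with
          delivered := True
          output := some (M, s.sigs, s.cert (.ready M s.ts))
          deadline := none }
        ∅
  | timeout (d : ℝ) (hd : s.deadline = some d) (hnow : d ≤ now) :
      LocalStep timeout now p s .timeout
        (LState.complain { s with deadline := none }).1
        (LState.complain { s with deadline := none }).2
  | complaint (k : Packet f V) (hk : s.Pending k) (hmsg : k.msg = .complaint s.leTs) :
      LocalStep timeout now p s (.complaint k)
        ((s.consume k).onComplaint timeout now k.src).1
        ((s.consume k).onComplaint timeout now k.src).2

/-- Events that a process executes by itself as soon as they are enabled: all but the requests of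
the user and the arrivals of packets. -/
def Event.Internal {f : ℕ} {V : Type*} : Event f V → Prop
  | .broadcast _ => False
  | .receive _ => False
  | _ => True

/-- A global configuration: the local states and all packets sent so far. -/
structure Config (f : ℕ) (V : Type*) where
  loc : Proc f → LState f V
  sent : Set (Packet f V)

/-- Steps of the system: an event at a correct process, Byzantine processes sending packets,
or nothing (time passes). -/
inductive Action (f : ℕ) (V : Type*) where
  | run (p : Proc f) (e : Event f V)
  | byzantine (S : Set (Packet f V))
  | idle

/-- The `n`-th step of the system, at time `now`; `B` is the set of Byzantine processes. These send
anything in their own names, but the links are authenticated and signatures of correct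
processes cannot be forged. -/
inductive Step {f : ℕ} {V : Type*} (timeout : ℕ → ℝ) (B : Finset (Proc f)) (n : ℕ) (now : ℝ)
    (c : Config f V) : Action f V → Config f V → Prop where
  | run (p : Proc f) (e : Event f V) (s' : LState f V) (o : Out f V) (hp : p ∉ B)
      (hnet : ∀ k, e = .receive k → k ∈ c.sent)
      (hstep : LocalStep timeout now p (c.loc p) e s' o) :
      Step timeout B n now c (.run p e)
        { loc := Function.update c.loc p s'
          sent := c.sent ∪ {k | k.id = n ∧ k.src = p ∧ (k.dst, k.msg) ∈ o} }
  | byzantine (S : Set (Packet f V)) (hid : ∀ k ∈ S, k.id = n) (hsrc : ∀ k ∈ S, k.src ∈ B)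
      (hsig : ∀ k ∈ S, ∀ p x, p ∉ B → (p, x) ∈ k.msg.carried →
        ∃ k' ∈ c.sent, k'.src = p ∧ k'.msg = .signed x) :
      Step timeout B n now c (.byzantine S) { c with sent := c.sent ∪ S }
  | idle : Step timeout B n now c .idle c

/-- An infinite timed execution. Step `n` happens at time `time n` and leads from configuration
`cfg n` to `cfg (n + 1)`. `p₀` is the initial leader, `gst` the global stabilization time and `δ` the
bound on message delays after it. -/
structure IsExecution {f : ℕ} {V : Type*} (timeout : ℕ → ℝ) (B : Finset (Proc f)) (p₀ : Proc f)
    (gst δ : ℝ) (cfg : ℕ → Config f V) (act : ℕ → Action f V) (time : ℕ → ℝ) : Prop where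
  time_zero : time 0 = 0
  time_mono : Monotone time
  time_unbounded : Filter.Tendsto time Filter.atTop Filter.atTop
  init : cfg 0 = { loc := fun _ => LState.init V timeout p₀, sent := ∅ }
  step : ∀ n, Step timeout B n (time n) (cfg n) (act n) (cfg (n + 1))
  /-- local computation takes no time: time advances only if no handler is enabled -/
  urgent : ∀ n, time n < time (n + 1) → ∀ p ∉ B, ∀ e : Event f V, e.Internal →
    ¬ ∃ s' o, LocalStep timeout (time n) p ((cfg (n + 1)).loc p) e s' o
  /-- time does not advance beyond the expiry of a running timer -/
  timer : ∀ n, ∀ p ∉ B, ∀ d, ((cfg (n + 1)).loc p).deadline = some d → time (n + 1) ≤ max (time n) d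
  /-- partial synchrony: packets between correct processes arrive, and within `δ` after `gst` -/
  synchrony : ∀ n, ∀ k ∈ (cfg n).sent, k.src ∉ B → k.dst ∉ B →
    ∃ j, act j = .run k.dst (.receive k) ∧ time j ≤ max (time k.id) gst + δ

/-- The process `p` broadcasts a message in the execution. -/
def Broadcasts {f : ℕ} {V : Type*} (act : ℕ → Action f V) (p : Proc f) : Prop :=
  ∃ n m, act n = .run p (.broadcast m)

/-- The process `p` eventually issues a response `deliver` for a set of messages. -/
def Delivers {f : ℕ} {V : Type*} (act : ℕ → Action f V) (p : Proc f) : Prop :=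
  ∃ n M, act n = .run p (.deliver M)

end BRD

/-!
Either the leader changes finitely often among the correct processes, or infinitely often.

If it changes finitely often, all correct processes end up in one term `T`, and their timers, which
are no longer reset, have all run out or been stopped. A timer that ran out led to a complaint, and
complaints of all correct processes would end the term; so some timer was stopped, by a quorum of
`Ready`. By amplification all correct processes then send `Ready`, for the same set because two
quorums of `Echo` share a correct process, and so all deliver.

If it changes infinitely often, consider late terms, whose timers exceed `6 δ`. A term lasts at
least its timeout after the first correct process enters it, since leaving it takes a complaint by a
correct process whose own timer ran out. Meanwhile the slowest correct process catches up, so that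
the lag between the first and the last entry eventually is at most `2 δ`. In a late term with a
correct leader, counted from the first entry, all have entered by `2 δ`, the leader has heard from
all of them by `3 δ`, and its aggregation, the `Echo` and the `Ready` messages take one further `δ`
each, before any timer of the term runs out.
-/

namespace BRD

open Filter

variable {f : ℕ} {V : Type*}

/-! ### Quorums -/

/-- `R` holds a packet of `p` with the message `x`. -/
def MsgFrom (R : Set (Packet f V)) (p : Proc f) (x : Msg f V) : Prop :=
  ∃ k ∈ R, k.src = p ∧ k.msg = x

/-- `R` holds packets with the message `x` of at least `a` distinct processes. -/
def Heard (R : Set (Packet f V)) (a : ℕ) (x : Msg f V) : Prop :=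
  ∃ Q : Finset (Proc f), a ≤ Q.card ∧ ∀ q ∈ Q, MsgFrom R q x

section Quorums

variable {R R' : Set (Packet f V)} {B : Finset (Proc f)} {a b : ℕ} {p : Proc f} {x y : Msg f V}

theorem MsgFrom.mono (h : MsgFrom R p x) (hR : R ⊆ R') : MsgFrom R' p x :=
  let ⟨k, hk, h'⟩ := h
  ⟨k, hR hk, h'⟩

theorem Heard.mono (h : Heard R a x) (hR : R ⊆ R') : Heard R' a x :=
  let ⟨Q, hQ, h'⟩ := h
  ⟨Q, hQ, fun q hq => (h' q hq).mono hR⟩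

theorem Heard.of_le (h : Heard R b x) (hab : a ≤ b) : Heard R a x :=
  let ⟨Q, hQ, h'⟩ := h
  ⟨Q, hab.trans hQ, h'⟩

theorem two_mul_lt_card_compl (hB : B.card ≤ f) : 2 * f < Bᶜ.card := by
  rw [Finset.card_compl, Fintype.card_fin]
  omega

theorem exists_correct (hB : B.card ≤ f) : ∃ p, p ∉ B := by
  obtain ⟨p, hp⟩ := Finset.card_pos.1 (Nat.zero_lt_of_lt (two_mul_lt_card_compl hB))
  exact ⟨p, Finset.mem_compl.1 hp⟩

theorem Heard.of_correct (hB : B.card ≤ f) (h : ∀ q ∉ B, MsgFrom R q x) :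
    Heard R (2 * f + 1) x :=
  ⟨Bᶜ, two_mul_lt_card_compl hB, fun q hq => h q (Finset.mem_compl.1 hq)⟩

theorem Heard.exists_correct (hB : B.card ≤ f) (h : Heard R (f + 1) x) :
    ∃ q ∉ B, MsgFrom R q x := by
  obtain ⟨Q, hQ, h⟩ := h
  obtain ⟨q, hq, hqB⟩ := Finset.exists_mem_notMem_of_card_lt_card (show B.card < Q.card by omega)
  exact ⟨q, hqB, h q hq⟩

theorem Heard.exists_correct_common (hB : B.card ≤ f) (hx : Heard R (2 * f + 1) x)
    (hy : Heard R (2 * f + 1) y) : ∃ q ∉ B, MsgFrom R q x ∧ MsgFrom R q y := by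
  obtain ⟨Q, hQ, hx⟩ := hx
  obtain ⟨Q', hQ', hy⟩ := hy
  have hunion : (Q ∪ Q').card ≤ 3 * f + 1 := by simpa using Finset.card_le_univ (Q ∪ Q')
  have hsum := Finset.card_union_add_card_inter Q Q'
  obtain ⟨q, hq, hqB⟩ := Finset.exists_mem_notMem_of_card_lt_card
    (show B.card < (Q ∩ Q').card by omega)
  rw [Finset.mem_inter] at hq
  exact ⟨q, hqB, hx q hq.1, hy q hq.2⟩

theorem Heard.of_add (hB : B.card ≤ f) (h : Heard R (a + f) x)
    (hR : ∀ q ∉ B, MsgFrom R q x → MsgFrom R' q x) : Heard R' a x := by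
  obtain ⟨Q, hQ, h⟩ := h
  have hcard := Finset.le_card_sdiff B Q
  refine ⟨Q \ B, by omega, fun q hq => ?_⟩
  rw [Finset.mem_sdiff] at hq
  exact hR q hq.2 (h q hq.1)

end Quorums

namespace LState

variable {s : LState f V}

theorem mem_senders {x : Stmt V} {p : Proc f} :
    p ∈ s.senders x ↔ MsgFrom s.received p (.signed x) := by
  simp [senders, MsgFrom]

theorem le_card_senders_iff {a : ℕ} {x : Stmt V} :
    a ≤ (s.senders x).card ↔ Heard s.received a (.signed x) :=
  ⟨fun h => ⟨_, h, fun _ hq => mem_senders.1 hq⟩, fun ⟨_, hQ, h⟩ =>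
    hQ.trans (Finset.card_le_card fun q hq => mem_senders.2 (h q hq))⟩

theorem sigCount_cert (x : Stmt V) : sigCount (s.cert x) x = (s.senders x).card := by
  simp [sigCount, cert]

theorem complain_fst : s.complain.1 = { s with leComplained := True } := by
  by_cases h : s.leComplained <;> cases s <;> simp_all [complain]

theorem mem_complain_snd {q : Proc f} {x : Msg f V} :
    (q, x) ∈ s.complain.2 ↔ ¬ s.leComplained ∧ x = .complaint s.leTs := by
  by_cases h : s.leComplained <;> simp [complain, h, toAll]

theorem proposal_eq_agg : ∃ M sigs, s.proposal = .agg M sigs s.ts := by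
  cases h : s.highValid with
  | none => exact ⟨s.M, s.sigs, by simp [proposal, h]⟩
  | some v => exact ⟨v.1, v.2.1, by simp [proposal, h]⟩

end LState

/-! ### Steps of a correct process -/

/-- The messages that correct processes send to everybody if they send them at all. -/
def Msg.Public : Msg f V → Prop
  | .signed (.contrib _ _) => False
  | .valid _ _ _ => False
  | _ => True

theorem LState.not_public_of_mem_newLeaderOut {s : LState f V} {p q : Proc f} {t : ℕ}
    {x : Msg f V} (h : (q, x) ∈ s.newLeaderOut p t) : ¬ x.Public := by
  unfold newLeaderOut at h
  split at h
  · simp_all [Msg.Public]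
  · split at h <;> simp_all [Msg.Public]

theorem LState.mem_changeOut {s : LState f V} {q : Proc f} {timeout : ℕ → ℝ} {now : ℝ}
    {x : Msg f V} (hx : x.Public) :
    (q, x) ∈ s.complain.2 ∪ (s.change timeout now).2 ↔
      ¬ s.leComplained ∧ x = .complaint s.leTs := by
  rw [Set.mem_union, mem_complain_snd, or_iff_left]
  exact fun h => not_public_of_mem_newLeaderOut h hx

/-- The steps of a correct process as seen by the proof: `LocalStep` with the election handlers
unfolded into their outcomes, and with the two causes of `Ready(M, ts)` merged. -/
inductive Transition (timeout : ℕ → ℝ) (now : ℝ) (p : Proc f) (s : LState f V) :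
    Event f V → LState f V → Out f V → Prop where
  | broadcast (m : V) (hfresh : s.myM = none) :
      Transition timeout now p s (.broadcast m)
        { s with myM := some m, deadline := some (now + timeout s.ts) }
        {(s.leader, .signed (.contrib m s.ts))}
  | receive (k : Packet f V) :
      Transition timeout now p s (.receive k) { s with received := insert k s.received } ∅
  | contribution (k : Packet f V) (m : V) (hmsg : k.msg = .signed (.contrib m s.ts)) :
      Transition timeout now p s (.contribution k) ((s.consume k).collect k.src m) ∅
  | validSet (k : Packet f V) (M : Finset V) (sigs : Finset (Sig f V)) (t : ℕ)
      (hk : k ∈ s.received) (hmsg : k.msg = .valid M sigs t) (hlead : p = s.leader)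
      (hcert : VoteCert M sigs t) :
      Transition timeout now p s (.validSet k) ((s.consume k).collectValid k.src (M, sigs, t)) ∅
  | propose (hq : 2 * f + 1 ≤ s.q.card) (hnew : ¬ s.proposed) :
      Transition timeout now p s .propose { s with proposed := True } (toAll s.proposal)
  | aggregation (k : Packet f V) (M : Finset V) (sigs : Finset (Sig f V)) (hk : k ∈ s.received)
      (hmsg : k.msg = .agg M sigs s.ts) (hsrc : k.src = s.leader) (hnew : ¬ s.echoed) :
      Transition timeout now p s (.aggregation k) { s.consume k with echoed := True }
        (toAll (.signed (.echo M s.ts)))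
  | ready (e : Event f V) (M : Finset V) (sigs : Finset (Sig f V))
      (hvotes : Heard s.received (2 * f + 1) (.signed (.echo M s.ts)) ∨
        Heard s.received (f + 1) (.signed (.ready M s.ts)))
      (hcert : VoteCert M sigs s.ts) (hnew : ¬ s.readied) :
      Transition timeout now p s e { s with readied := True, valid := some (M, sigs, s.ts) }
        (toAll (.signed (.ready M s.ts)))
  | deliver (M : Finset V) (hvotes : Heard s.received (2 * f + 1) (.signed (.ready M s.ts)))
      (output : Option (Finset V × Finset (Sig f V) × Finset (Sig f V))) :
      Transition timeout now p s (.deliver M)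
        { s with delivered := True, output := output, deadline := none } ∅
  | timeout (d : ℝ) (hd : s.deadline = some d) (hnow : d ≤ now) :
      Transition timeout now p s .timeout { s with deadline := none, leComplained := True }
        s.complain.2
  | countComplaint (k : Packet f V) (hk : k ∈ s.received) (hmsg : k.msg = .complaint s.leTs)
      (hcard : (insert k.src s.leC).card ≤ f) :
      Transition timeout now p s (.complaint k) { s.consume k with leC := insert k.src s.leC } ∅
  | amplify (k : Packet f V) (hk : k ∈ s.received) (hmsg : k.msg = .complaint s.leTs)
      (hcard : f + 1 ≤ (insert k.src s.leC).card) (hcard' : (insert k.src s.leC).card ≤ 2 * f) :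
      Transition timeout now p s (.complaint k)
        { s.consume k with leC := insert k.src s.leC, leComplained := True } s.complain.2
  | change (k : Packet f V) (hk : k ∈ s.received) (hmsg : k.msg = .complaint s.leTs)
      (hcard : 2 * f + 1 ≤ (insert k.src s.leC).card) :
      Transition timeout now p s (.complaint k) ((s.consume k).change timeout now).1
        (s.complain.2 ∪ (s.change timeout now).2)

section Transition

variable {timeout : ℕ → ℝ} {now : ℝ} {p : Proc f} {s s' : LState f V} {e : Event f V}
  {o : Out f V}

theorem transition_complaint {k : Packet f V} (hk : k ∈ s.received)
    (hmsg : k.msg = .complaint s.leTs) :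
    Transition timeout now p s (.complaint k) ((s.consume k).onComplaint timeout now k.src).1
      ((s.consume k).onComplaint timeout now k.src).2 := by
  classical
  have hsnd (C H) : (LState.complain { s with leC := C, handled := H }).2 = s.complain.2 := by
    ext ⟨q, x⟩
    simp only [LState.mem_complain_snd]
  by_cases h₁ : f + 1 ≤ (insert k.src s.leC).card
  · by_cases h₂ : 2 * f + 1 ≤ (insert k.src s.leC).card
    · convert Transition.change (timeout := timeout) (now := now) (p := p) k hk hmsg
        (by convert h₂) using 1 <;>
        simp [LState.onComplaint, LState.consume, h₁, h₂, LState.complain_fst, LState.change, hsnd,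
          LState.newLeader, LState.newLeaderOut]
    · convert Transition.amplify (timeout := timeout) (now := now) (p := p) k hk hmsg
        (by convert h₁) (by convert Nat.le_of_lt_succ (not_le.1 h₂)) using 1 <;>
        simp [LState.onComplaint, LState.consume, h₁, h₂, LState.complain_fst, hsnd]
  · have h₂ : ¬ 2 * f + 1 ≤ (insert k.src s.leC).card := by omega
    convert Transition.countComplaint (timeout := timeout) (now := now) (p := p) k hk hmsg
      (by convert Nat.le_of_lt_succ (not_le.1 h₁)) using 1 <;>
      simp [LState.onComplaint, LState.consume, h₁, h₂]

theorem LocalStep.transition (h : LocalStep timeout now p s e s' o) :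
    Transition timeout now p s e s' o := by
  cases h with
  | broadcast m h => exact .broadcast m h
  | receive k hdst hnew => exact .receive k
  | contribution k m hk hmsg hlead => exact .contribution k m hmsg
  | validSet k M sigs t hk hmsg hlead hatt => exact .validSet k M sigs t hk.1 hmsg hlead hatt
  | propose hq hnew => exact .propose hq hnew
  | aggregation k M sigs hk hmsg hsrc hnew hatt => exact .aggregation k M sigs hk.1 hmsg hsrc hnew
  | echoQuorum M hq hnew =>
    exact .ready _ M _ (.inl (LState.le_card_senders_iff.1 hq))
      (.inl (by rwa [LState.sigCount_cert])) hnew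
  | readyAmplify M hq hnew =>
    exact .ready _ M _ (.inr (LState.le_card_senders_iff.1 hq))
      (.inr (by rwa [LState.sigCount_cert])) hnew
  | deliver M hq hnew => exact .deliver M (LState.le_card_senders_iff.1 hq) _
  | timeout d hd hnow =>
    have hsnd : (LState.complain { s with deadline := none }).2 = s.complain.2 := by
      ext ⟨q, x⟩
      simp only [LState.mem_complain_snd]
    rw [LState.complain_fst, hsnd]
    exact .timeout d hd hnow
  | complaint k hk hmsg => exact transition_complaint hk.1 hmsg

end Transition

/-! ### Invariants of the local state -/

/-- The election variables of a correct process match its leader, its timestamp and the complaints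
it received. -/
structure ElectionInv (s : LState f V) : Prop where
  one_le_leTs : 1 ≤ s.leTs
  ts_eq : s.ts = if s.leTs = 1 then 0 else s.leTs
  leader_eq : 2 ≤ s.leTs → s.leader = Fin.ofNat (3 * f + 1) s.leTs
  card_leC_le : s.leC.card ≤ 2 * f
  received_of_mem_leC : ∀ q ∈ s.leC, MsgFrom s.received q (.complaint s.leTs)
  leComplained_of_card : f + 1 ≤ s.leC.card → s.leComplained

/-- A packet is consumed only under its own timestamp or a later one, and consuming it under its own
timestamp has left its trace in the state. -/
structure HandledInv (s : LState f V) : Prop where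
  complaint : ∀ k ∈ s.handled, ∀ t, k.msg = .complaint t →
    t ≤ s.leTs ∧ (t = s.leTs → k.src ∈ s.leC)
  contrib : ∀ k ∈ s.handled, ∀ m t, k.msg = .signed (.contrib m t) →
    t ≤ s.ts ∧ (t = s.ts → k.src ∈ s.q)
  agg : ∀ k ∈ s.handled, ∀ M sigs t, k.msg = .agg M sigs t → t ≤ s.ts ∧ (t = s.ts → s.echoed)

/-- The collection of a leader and the kept valid sets are backed by signatures. -/
structure CollectionInv (s : LState f V) : Prop where
  voteCert_valid : ∀ v, s.valid = some v → VoteCert v.1 v.2.1 v.2.2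
  voteCert_highValid : ∀ v, s.highValid = some v → VoteCert v.1 v.2.1 v.2.2
  mem_sigs_of_mem_q : s.highValid = none → ∀ p ∈ s.q, ∃ m, (p, Stmt.contrib m s.ts) ∈ s.sigs
  mem_M_iff : ∀ m, m ∈ s.M ↔ ∃ p, (p, Stmt.contrib m s.ts) ∈ s.sigs

/-- A timer that is not running has expired or was stopped by a delivery. -/
def TimerInv (s : LState f V) : Prop :=
  s.deadline = none →
    s.leComplained ∨ ∃ M, Heard s.received (2 * f + 1) (.signed (.ready M s.ts))

/-- The invariant of the local states of correct processes. -/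
structure LocalInv (s : LState f V) : Prop extends
  ElectionInv s, HandledInv s, CollectionInv s where
  timer : TimerInv s

section LocalInv

variable {timeout : ℕ → ℝ} {now : ℝ} {p p₀ : Proc f} {s s' : LState f V} {e : Event f V}
  {o : Out f V}

theorem ElectionInv.ts_le_leTs (hs : ElectionInv s) : s.ts ≤ s.leTs := by
  have := hs.ts_eq
  split at this <;> omega

theorem ElectionInv.ts_eq_leTs (hs : ElectionInv s) (h : 2 ≤ s.leTs) : s.ts = s.leTs := by
  rw [hs.ts_eq, if_neg (by omega)]

theorem ElectionInv.heard_insert (hs : ElectionInv s) {k : Packet f V} (hk : k ∈ s.received)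
    (hmsg : k.msg = .complaint s.leTs) {a : ℕ} (ha : a ≤ (insert k.src s.leC).card) :
    Heard s.received a (.complaint s.leTs) := by
  refine ⟨_, ha, fun q hq => ?_⟩
  rcases Finset.mem_insert.1 hq with rfl | hq
  · exact ⟨k, hk, rfl, hmsg⟩
  · exact hs.received_of_mem_leC q hq

theorem CollectionInv.attests (hs : CollectionInv s) (hq : 2 * f + 1 ≤ s.q.card) {M : Finset V}
    {sigs : Finset (Sig f V)} {t : ℕ} (h : s.proposal = .agg M sigs t) : Attests M sigs t := by
  classical
  unfold LState.proposal at h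
  split at h
  · obtain ⟨rfl, rfl, rfl⟩ := Msg.agg.inj h
    refine .inl ⟨hq.trans (Finset.card_le_card fun p hp => ?_), hs.mem_M_iff⟩
    exact Finset.mem_filter.2 ⟨Finset.mem_univ p, hs.mem_sigs_of_mem_q ‹_› p hp⟩
  · obtain ⟨rfl, rfl, rfl⟩ := Msg.agg.inj h
    exact .inr ⟨_, hs.voteCert_highValid _ ‹_›⟩

theorem ElectionInv.step (hs : ElectionInv s) (h : Transition timeout now p s e s' o) :
    ElectionInv s' := by
  obtain ⟨h1, h2, h3, h4, h5, h6⟩ := hs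
  cases h
  case change =>
    constructor <;> simp only [LState.consume, LState.change, LState.newLeader] <;> grind
  all_goals
    constructor <;> grind [LState.consume, LState.collect, LState.collectValid, MsgFrom]

theorem HandledInv.step (hs : HandledInv s) (he : ElectionInv s)
    (h : Transition timeout now p s e s' o) : HandledInv s' := by
  have hle := he.ts_le_leTs
  obtain ⟨h1, h2, h3⟩ := hs
  cases h
  all_goals
    constructor <;> grind [LState.consume, LState.collect, LState.collectValid, LState.change,
      LState.newLeader]

theorem CollectionInv.step (hs : CollectionInv s) (h : Transition timeout now p s e s' o) :
    CollectionInv s' := by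
  classical
  obtain ⟨h1, h2, h3, h4⟩ := hs
  cases h
  case contribution k m hmsg =>
    constructor <;> simp [LState.consume, LState.collect] <;> grind
  all_goals
    constructor <;> grind [LState.consume, LState.collectValid, LState.change, LState.newLeader]

theorem TimerInv.step (hs : TimerInv s) (h : Transition timeout now p s e s' o) :
    TimerInv s' := by
  unfold TimerInv at *
  cases h
  all_goals grind [LState.consume, LState.collect, LState.collectValid, LState.change,
    LState.newLeader, Heard.mono]

theorem LocalInv.step (hs : LocalInv s) (h : Transition timeout now p s e s' o) :
    LocalInv s' where
  toElectionInv := hs.toElectionInv.step h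
  toHandledInv := hs.toHandledInv.step hs.toElectionInv h
  toCollectionInv := hs.toCollectionInv.step h
  timer := hs.timer.step h

theorem LocalInv.init : LocalInv (LState.init V timeout p₀) := by
  constructor
  · constructor <;> simp [LState.init]
  · constructor <;> simp [LState.init]
  · constructor <;> simp [LState.init]
  · simp [TimerInv, LState.init]

end LocalInv

section Casts

variable {α : Type*} {y : α → ℕ → Msg f V} {S : Msg f V → Prop} {o : Out f V} {t t' : ℕ}
  {flag flag' : Prop}

/-! ### Messages sent by a correct process -/

/-- Among the messages `S` sent by a process there is at most one of the family `y` per timestamp,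
and none for a timestamp after `t`; `flag` tells whether there is one for `t`. -/
structure CastInv (y : α → ℕ → Msg f V) (S : Msg f V → Prop) (t : ℕ) (flag : Prop) : Prop where
  le : ∀ a u, S (y a u) → u ≤ t ∧ (u = t → flag)
  unique : ∀ a b u, S (y a u) → S (y b u) → a = b
  exists_sent : flag → ∃ a, S (y a t)

/-- The effect of one step with output `o` on the timestamp and on the flag that guards the
broadcast of a family `y` of messages. -/
inductive CastStep (y : α → ℕ → Msg f V) (o : Out f V) (t : ℕ) (flag : Prop) :
    ℕ → Prop → Prop where
  | idle (ho : ∀ q a u, (q, y a u) ∉ o) : CastStep y o t flag t flag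
  | advance {t' : ℕ} (ho : ∀ q a u, (q, y a u) ∉ o) (ht : t < t') : CastStep y o t flag t' False
  | cast (a : α) (ho : o = toAll (y a t)) (hflag : ¬ flag) : CastStep y o t flag t True

theorem CastInv.step (hy : Function.Injective2 y) (hS : CastInv y S t flag)
    (h : CastStep y o t flag t' flag') :
    CastInv y (fun x => S x ∨ ∃ q, (q, x) ∈ o) t' flag' := by
  obtain ⟨hle, hunique, hexists⟩ := hS
  cases h with
  | idle ho => constructor <;> grind
  | advance ho ht => constructor <;> grind
  | cast a ho hflag =>
    subst ho
    have hcast b u : (∃ q, (q, y b u) ∈ toAll (f := f) (y a t)) ↔ b = a ∧ u = t :=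
      ⟨fun ⟨_, h⟩ => hy h, fun ⟨hb, hu⟩ => ⟨0, by rw [hb, hu]; rfl⟩⟩
    constructor <;> simp only [hcast] <;> grind

theorem CastInv.empty : CastInv y (fun _ => False) t False := by
  constructor <;> simp

end Casts

section Output

variable {timeout : ℕ → ℝ} {now : ℝ} {p q : Proc f} {s s' : LState f V} {e : Event f V}
  {o : Out f V} {x : Msg f V} {M : Finset V} {sigs : Finset (Sig f V)} {t : ℕ}

theorem Transition.leTs_le (h : Transition timeout now p s e s' o) : s.leTs ≤ s'.leTs := by
  cases h <;> simp [LState.consume, LState.collect, LState.collectValid, LState.change,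
    LState.newLeader]

theorem Transition.received_subset (h : Transition timeout now p s e s' o) :
    s.received ⊆ s'.received := by
  cases h <;> simp [LState.consume, LState.collect, LState.collectValid, LState.change,
    LState.newLeader]

theorem Transition.mem_received (h : Transition timeout now p s e s' o) {k : Packet f V}
    (hk : k ∈ s'.received) : k ∈ s.received ∨ e = .receive k := by
  cases h
  case receive => exact hk.symm.imp_right (congrArg Event.receive ·.symm)
  all_goals exact .inl hk

theorem LocalStep.mem_received {k : Packet f V}
    (h : LocalStep timeout now p s (.receive k) s' o) : k ∈ s'.received := by
  cases h
  exact Set.mem_insert k _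

theorem Transition.delivered (h : Transition timeout now p s e s' o) (hd : s'.delivered) :
    s.delivered ∨ ∃ M, e = .deliver M := by
  cases h
  case deliver M _ _ => exact .inr ⟨M, rfl⟩
  all_goals exact .inl hd

theorem Transition.myM_ne_none (h : Transition timeout now p s e s' o) (hm : s.myM ≠ none) :
    s'.myM ≠ none := by
  cases h <;> simp_all [LState.consume, LState.collect, LState.collectValid, LState.change,
    LState.newLeader]

theorem Transition.mem_out_of_public (h : Transition timeout now p s e s' o) (hx : x.Public)
    (hq : (q, x) ∈ o) (q' : Proc f) : (q', x) ∈ o := by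
  cases h
  case change =>
    exact (LState.mem_changeOut hx).2 ((LState.mem_changeOut hx).1 hq)
  all_goals simp_all [LState.mem_complain_snd, toAll, Msg.Public]

theorem Transition.complaint_mem_out (h : Transition timeout now p s e s' o) (hs : ElectionInv s)
    (hq : (q, .complaint t) ∈ o) :
    t = s.leTs ∧ ((∃ d, s.deadline = some d ∧ d ≤ now) ∨
      Heard s.received (f + 1) (.complaint s.leTs)) := by
  cases h
  case change k hk hmsg hcard =>
    refine ⟨?_, .inr (hs.heard_insert hk hmsg (by omega))⟩
    simpa using (LState.mem_changeOut (by trivial)).1 hq |>.2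
  case amplify k hk hmsg hcard _ =>
    exact ⟨by simpa using (LState.mem_complain_snd.1 hq).2, .inr (hs.heard_insert hk hmsg hcard)⟩
  case timeout d hd hnow =>
    exact ⟨by simpa using (LState.mem_complain_snd.1 hq).2, .inl ⟨d, hd, hnow⟩⟩
  case propose =>
    obtain ⟨M, sigs, h⟩ := s.proposal_eq_agg
    simp_all [toAll]
  all_goals simp_all [toAll]

theorem Transition.ready_mem_out (h : Transition timeout now p s e s' o)
    (hq : (q, .signed (.ready M t)) ∈ o) :
    t = s.ts ∧ (Heard s.received (2 * f + 1) (.signed (.echo M t)) ∨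
      Heard s.received (f + 1) (.signed (.ready M t))) := by
  cases h
  case change => simpa using (LState.mem_changeOut (by trivial)).1 hq
  case propose =>
    obtain ⟨M, sigs, h⟩ := s.proposal_eq_agg
    simp_all [toAll]
  all_goals simp_all [toAll, LState.mem_complain_snd]

theorem Transition.echo_mem_out (h : Transition timeout now p s e s' o)
    (hq : (q, .signed (.echo M t)) ∈ o) :
    t = s.ts ∧ ∃ sigs, MsgFrom s.received s.leader (.agg M sigs t) := by
  cases h
  case change => simpa using (LState.mem_changeOut (by trivial)).1 hq
  case propose =>
    obtain ⟨M, sigs, h⟩ := s.proposal_eq_agg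
    simp_all [toAll]
  case aggregation k M' sigs hk hmsg hsrc _ =>
    obtain ⟨rfl, rfl⟩ : M = M' ∧ t = s.ts := by simpa [toAll] using hq
    exact ⟨rfl, sigs, k, hk, hsrc, hmsg⟩
  all_goals simp_all [toAll, LState.mem_complain_snd]

theorem Transition.attests_of_agg_mem_out (h : Transition timeout now p s e s' o)
    (hs : CollectionInv s) (hq : (q, .agg M sigs t) ∈ o) : Attests M sigs t := by
  cases h
  case change => simpa using (LState.mem_changeOut (by trivial)).1 hq
  case propose hcard _ => exact hs.attests hcard hq.symm
  all_goals simp_all [toAll, LState.mem_complain_snd]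

theorem Transition.castStep_agg (h : Transition timeout now p s e s' o) (hs : ElectionInv s) :
    CastStep (fun (a : Finset V × Finset (Sig f V)) t => .agg a.1 a.2 t) o s.ts s.proposed
      s'.ts s'.proposed := by
  cases h
  case propose _ hnew =>
    obtain ⟨M, sigs, h⟩ := s.proposal_eq_agg
    exact .cast (M, sigs) (by rw [h]) hnew
  case change =>
    exact .advance (fun q a u hq => by simpa using (LState.mem_changeOut (by trivial)).1 hq)
      (Nat.lt_succ_of_le hs.ts_le_leTs)
  all_goals exact .idle (by simp [toAll, LState.mem_complain_snd])

theorem Transition.castStep_echo (h : Transition timeout now p s e s' o) (hs : ElectionInv s) :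
    CastStep (fun (M : Finset V) t => .signed (.echo M t)) o s.ts s.echoed s'.ts s'.echoed := by
  cases h
  case aggregation k M sigs hk hmsg hsrc hnew => exact .cast M rfl hnew
  case propose =>
    obtain ⟨M, sigs, h⟩ := s.proposal_eq_agg
    exact .idle (by simp [toAll, h])
  case change =>
    exact .advance (fun q a u hq => by simpa using (LState.mem_changeOut (by trivial)).1 hq)
      (Nat.lt_succ_of_le hs.ts_le_leTs)
  all_goals exact .idle (by simp [toAll, LState.mem_complain_snd])

theorem Transition.castStep_ready (h : Transition timeout now p s e s' o) (hs : ElectionInv s) :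
    CastStep (fun (M : Finset V) t => .signed (.ready M t)) o s.ts s.readied s'.ts s'.readied := by
  cases h
  case ready M sigs _ _ hnew => exact .cast M rfl hnew
  case propose =>
    obtain ⟨M, sigs, h⟩ := s.proposal_eq_agg
    exact .idle (by simp [toAll, h])
  case change =>
    exact .advance (fun q a u hq => by simpa using (LState.mem_changeOut (by trivial)).1 hq)
      (Nat.lt_succ_of_le hs.ts_le_leTs)
  all_goals exact .idle (by simp [toAll, LState.mem_complain_snd])

/-- The complaints among the messages `S` sent by a process in state `s` include those for all
timestamps that it has left. -/
structure ComplaintInv (S : Msg f V → Prop) (s : LState f V) : Prop where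
  current : s.leComplained → S (.complaint s.leTs)
  earlier : ∀ t, 1 ≤ t → t < s.leTs → S (.complaint t)

theorem ComplaintInv.step {S : Msg f V → Prop} (hS : ComplaintInv S s)
    (h : Transition timeout now p s e s' o) :
    ComplaintInv (fun x => S x ∨ ∃ q, (q, x) ∈ o) s' := by
  have hcurrent (hnew : ∀ q, (q, .complaint s.leTs) ∈ s.complain.2 → (q, .complaint s.leTs) ∈ o) :
      S (.complaint s.leTs) ∨ ∃ q, (q, .complaint s.leTs) ∈ o :=
    (em s.leComplained).imp hS.current fun hc => ⟨0, hnew 0 (LState.mem_complain_snd.2 ⟨hc, rfl⟩)⟩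
  obtain ⟨h1, h2⟩ := hS
  cases h
  case timeout => exact ⟨fun _ => hcurrent fun _ => id, fun t ht ht' => .inl (h2 t ht ht')⟩
  case amplify => exact ⟨fun _ => hcurrent fun _ => id, fun t ht ht' => .inl (h2 t ht ht')⟩
  case change =>
    refine ⟨fun h => h.elim, fun t ht ht' => ?_⟩
    rcases (Nat.lt_succ_iff.1 ht').lt_or_eq with ht' | rfl
    · exact .inl (h2 t ht ht')
    · exact hcurrent fun _ => .inl
  all_goals exact ⟨fun h => .inl (h1 h), fun t ht ht' => .inl (h2 t ht ht')⟩

theorem Transition.change_of_leTs_lt (h : Transition timeout now p s e s' o) (hs : ElectionInv s)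
    (hlt : s.leTs < s'.leTs) :
    s'.leTs = s.leTs + 1 ∧ Heard s.received (2 * f + 1) (.complaint s.leTs) ∧
      s.newLeaderOut (Fin.ofNat _ (s.leTs + 1)) (s.leTs + 1) ⊆ o := by
  cases h
  case change k hk hmsg hcard =>
    exact ⟨rfl, hs.heard_insert hk hmsg hcard, Set.subset_union_right⟩
  all_goals exact absurd hlt (lt_irrefl _)

theorem Transition.deadline_eq (h : Transition timeout now p s e s' o) :
    s'.deadline = none ∨ s'.deadline = s.deadline ∧ s'.leTs = s.leTs ∨
      s'.deadline = some (now + timeout s'.ts) ∧ (s.myM = none ∨ s.leTs < s'.leTs) := by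
  cases h
  case broadcast hfresh => exact .inr (.inr ⟨rfl, .inl hfresh⟩)
  case change => exact .inr (.inr ⟨rfl, .inr (Nat.lt_succ_self _)⟩)
  case deliver => exact .inl rfl
  case timeout => exact .inl rfl
  all_goals exact .inr (.inl ⟨rfl, rfl⟩)

end Output

/-! ### Executions -/

/-- Step `n` executes the event `e` at the process `p`, which sends `o`. -/
structure RunsAt (timeout : ℕ → ℝ) (cfg : ℕ → Config f V) (act : ℕ → Action f V) (time : ℕ → ℝ)
    (n : ℕ) (p : Proc f) (e : Event f V) (o : Out f V) : Prop where
  act_eq : act n = .run p e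
  mem_sent : ∀ k, e = .receive k → k ∈ (cfg n).sent
  localStep : LocalStep timeout (time n) p ((cfg n).loc p) e ((cfg (n + 1)).loc p) o
  sent_eq : (cfg (n + 1)).sent =
    (cfg n).sent ∪ {k | k.id = n ∧ k.src = p ∧ (k.dst, k.msg) ∈ o}

namespace RunsAt

variable {timeout : ℕ → ℝ} {cfg : ℕ → Config f V} {act : ℕ → Action f V} {time : ℕ → ℝ}
  {n : ℕ} {p q : Proc f} {e : Event f V} {o : Out f V} {x : Msg f V}

theorem transition (h : RunsAt timeout cfg act time n p e o) :
    Transition timeout (time n) p ((cfg n).loc p) e ((cfg (n + 1)).loc p) o :=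
  h.localStep.transition

theorem mem_sent_succ (h : RunsAt timeout cfg act time n p e o) (hx : (q, x) ∈ o) :
    ⟨n, p, q, x⟩ ∈ (cfg (n + 1)).sent := by
  rw [h.sent_eq]
  exact .inr ⟨rfl, rfl, hx⟩

theorem msgFrom_sent_succ (h : RunsAt timeout cfg act time n p e o) :
    MsgFrom (cfg (n + 1)).sent p x ↔ MsgFrom (cfg n).sent p x ∨ ∃ q, (q, x) ∈ o := by
  constructor
  · rintro ⟨k, hk, hsrc, rfl⟩
    rw [h.sent_eq] at hk
    exact hk.imp (fun hk => ⟨k, hk, hsrc, rfl⟩) fun hk => ⟨_, hk.2.2⟩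
  · rintro (hx | ⟨q, hx⟩)
    · exact hx.mono (h.sent_eq ▸ Set.subset_union_left)
    · exact ⟨_, h.mem_sent_succ hx, rfl, rfl⟩

end RunsAt

namespace IsExecution

variable {timeout : ℕ → ℝ} {B : Finset (Proc f)} {p₀ : Proc f} {gst δ : ℝ}
  {cfg : ℕ → Config f V} {act : ℕ → Action f V} {time : ℕ → ℝ}
  (hexec : IsExecution timeout B p₀ gst δ cfg act time)
  {m n t : ℕ} {p q : Proc f} {e : Event f V} {o : Out f V} {x : Msg f V} {M M' : Finset V}
  {sigs : Finset (Sig f V)}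

include hexec

theorem exists_runsAt (h : act n = .run p e) :
    p ∉ B ∧ ∃ o, RunsAt timeout cfg act time n p e o := by
  have hstep := hexec.step n
  rw [h] at hstep
  generalize hc : cfg (n + 1) = c at hstep
  cases hstep with
  | run _ _ s' o hp hnet hlocal => exact ⟨hp, o, h, hnet, by simpa [hc] using hlocal, by simp [hc]⟩

theorem runsAt_or_unchanged (hp : p ∉ B) (n : ℕ) :
    (∃ e o, RunsAt timeout cfg act time n p e o) ∨ (cfg (n + 1)).loc p = (cfg n).loc p ∧
      ∀ x, MsgFrom (cfg (n + 1)).sent p x ↔ MsgFrom (cfg n).sent p x := by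
  by_cases hrun : ∃ e, act n = .run p e
  · obtain ⟨e, he⟩ := hrun
    exact .inl ⟨e, (hexec.exists_runsAt he).2⟩
  · have hstep := hexec.step n
    generalize act n = a, cfg (n + 1) = c at *
    refine .inr ?_
    cases hstep with
    | run q e s' o hq hnet hlocal =>
      have hqp : p ≠ q := by
        rintro rfl
        exact hrun ⟨e, rfl⟩
      refine ⟨by simp [hqp], fun x => ?_⟩
      simp only [MsgFrom, Set.mem_union, Set.mem_ofPred_eq]
      grind
    | byzantine S hid hsrc hsig =>
      refine ⟨rfl, fun x => ?_⟩
      simp only [MsgFrom, Set.mem_union]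
      grind
    | idle => exact ⟨rfl, fun x => Iff.rfl⟩

theorem monotone_sent : Monotone fun n => (cfg n).sent := by
  refine monotone_nat_of_le_succ fun n => ?_
  have hstep := hexec.step n
  generalize act n = a, cfg (n + 1) = c at *
  cases hstep with
  | run => exact Set.subset_union_left
  | byzantine => exact Set.subset_union_left
  | idle => exact le_rfl

theorem id_lt {k : Packet f V} (hk : k ∈ (cfg n).sent) : k.id < n := by
  induction n with
  | zero => simp [hexec.init] at hk
  | succ n ih =>
    have hstep := hexec.step n
    generalize act n = a, cfg (n + 1) = c at *
    suffices k ∈ (cfg n).sent ∨ k.id = n from this.elim (fun hk => (ih hk).trans n.lt_succ_self)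
      fun hk => hk.trans_lt n.lt_succ_self
    cases hstep with
    | run => exact hk.imp_right And.left
    | byzantine S hid => exact hk.imp_right (hid k)
    | idle => exact .inl hk

theorem induction (hp : p ∉ B) {I : (Msg f V → Prop) → LState f V → Prop}
    (init : I (fun _ => False) (LState.init V timeout p₀))
    (step : ∀ n e s' o, Transition timeout (time n) p ((cfg n).loc p) e s' o →
      I (MsgFrom (cfg n).sent p) ((cfg n).loc p) →
      I (fun x => MsgFrom (cfg n).sent p x ∨ ∃ q, (q, x) ∈ o) s') (n : ℕ) :
    I (MsgFrom (cfg n).sent p) ((cfg n).loc p) := by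
  induction n with
  | zero =>
    rw [show MsgFrom (cfg 0).sent p = fun _ => False by funext x; simp [hexec.init, MsgFrom],
      hexec.init]
    exact init
  | succ n ih =>
    rcases hexec.runsAt_or_unchanged hp n with ⟨e, o, h⟩ | ⟨hloc, hsent⟩
    · rw [show MsgFrom (cfg (n + 1)).sent p = _ from funext fun x => propext h.msgFrom_sent_succ]
      exact step n e _ o h.transition ih
    · rwa [hloc, show MsgFrom (cfg (n + 1)).sent p = _ from funext fun x => propext (hsent x)]

theorem localInv (hp : p ∉ B) (n : ℕ) : LocalInv ((cfg n).loc p) :=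
  hexec.induction hp (I := fun _ => LocalInv) .init (fun _ _ _ _ h hs => hs.step h) n

theorem castInv_agg (hp : p ∉ B) (n : ℕ) :
    CastInv (fun (a : Finset V × Finset (Sig f V)) t => .agg a.1 a.2 t) (MsgFrom (cfg n).sent p)
      ((cfg n).loc p).ts ((cfg n).loc p).proposed :=
  hexec.induction hp
    (I := fun S s => CastInv (fun (a : Finset V × Finset (Sig f V)) t => .agg a.1 a.2 t) S s.ts
      s.proposed)
    .empty (fun n _ _ _ h hS => hS.step
      (fun _ _ _ _ h => by simpa [Prod.ext_iff, and_assoc] using h)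
      (h.castStep_agg (hexec.localInv hp n).toElectionInv)) n

theorem castInv_echo (hp : p ∉ B) (n : ℕ) :
    CastInv (fun (M : Finset V) t => .signed (.echo M t)) (MsgFrom (cfg n).sent p)
      ((cfg n).loc p).ts ((cfg n).loc p).echoed :=
  hexec.induction hp (I := fun S s => CastInv (fun M t => .signed (.echo M t)) S s.ts s.echoed)
    .empty (fun n _ _ _ h hS => hS.step (fun _ _ _ _ h => by simpa using h)
      (h.castStep_echo (hexec.localInv hp n).toElectionInv)) n

theorem castInv_ready (hp : p ∉ B) (n : ℕ) :
    CastInv (fun (M : Finset V) t => .signed (.ready M t)) (MsgFrom (cfg n).sent p)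
      ((cfg n).loc p).ts ((cfg n).loc p).readied :=
  hexec.induction hp (I := fun S s => CastInv (fun M t => .signed (.ready M t)) S s.ts s.readied)
    .empty (fun n _ _ _ h hS => hS.step (fun _ _ _ _ h => by simpa using h)
      (h.castStep_ready (hexec.localInv hp n).toElectionInv)) n

theorem complaintInv (hp : p ∉ B) (n : ℕ) :
    ComplaintInv (MsgFrom (cfg n).sent p) ((cfg n).loc p) :=
  hexec.induction hp ⟨False.elim, fun t ht ht' => by simp [LState.init] at ht'; omega⟩
    (fun _ _ _ _ h hS => hS.step h) n

theorem monotone_leTs (hp : p ∉ B) : Monotone fun n => ((cfg n).loc p).leTs := by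
  refine monotone_nat_of_le_succ fun n => ?_
  rcases hexec.runsAt_or_unchanged hp n with ⟨e, o, h⟩ | ⟨h, -⟩
  · exact h.transition.leTs_le
  · rw [h]

theorem monotone_received (hp : p ∉ B) : Monotone fun n => ((cfg n).loc p).received := by
  refine monotone_nat_of_le_succ fun n => ?_
  rcases hexec.runsAt_or_unchanged hp n with ⟨e, o, h⟩ | ⟨h, -⟩
  · exact h.transition.received_subset
  · rw [h]

theorem myM_ne_none (hp : p ∉ B) (hm : ((cfg m).loc p).myM ≠ none) (hmn : m ≤ n) :
    ((cfg n).loc p).myM ≠ none := by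
  induction n, hmn using Nat.le_induction with
  | base => exact hm
  | succ n _ ih =>
    rcases hexec.runsAt_or_unchanged hp n with ⟨e, o, h⟩ | ⟨h, -⟩
    · exact h.transition.myM_ne_none ih
    · rwa [h]

theorem received_subset_sent (hp : p ∉ B) (n : ℕ) : ((cfg n).loc p).received ⊆ (cfg n).sent := by
  induction n with
  | zero => simp [hexec.init, LState.init]
  | succ n ih =>
    have hmono := hexec.monotone_sent n.le_succ
    rcases hexec.runsAt_or_unchanged hp n with ⟨e, o, h⟩ | ⟨hloc, -⟩
    · exact fun k hk => (h.transition.mem_received hk).elim (fun hk => hmono (ih hk))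
        fun he => hmono (h.mem_sent k he)
    · rw [hloc]
      exact ih.trans hmono

theorem delivers (hp : p ∉ B) (h : ((cfg n).loc p).delivered) : Delivers act p := by
  induction n with
  | zero => simp [hexec.init, LState.init] at h
  | succ n ih =>
    rcases hexec.runsAt_or_unchanged hp n with ⟨e, o, hrun⟩ | ⟨hloc, -⟩
    · exact (hrun.transition.delivered h).elim ih fun ⟨M, hM⟩ => ⟨n, M, hM ▸ hrun.act_eq⟩
    · exact ih (hloc ▸ h)

theorem exists_runsAt_of_msgFrom_sent (hp : p ∉ B) (h : MsgFrom (cfg n).sent p x) :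
    ∃ i < n, ∃ e o q, RunsAt timeout cfg act time i p e o ∧ (q, x) ∈ o := by
  induction n with
  | zero => simp [hexec.init, MsgFrom] at h
  | succ n ih =>
    by_cases hn : MsgFrom (cfg n).sent p x
    · obtain ⟨i, hi, hrun⟩ := ih hn
      exact ⟨i, hi.trans n.lt_succ_self, hrun⟩
    rcases hexec.runsAt_or_unchanged hp n with ⟨e, o, hrun⟩ | ⟨-, hsent⟩
    · obtain ⟨q, hq⟩ := (hrun.msgFrom_sent_succ.1 h).resolve_left hn
      exact ⟨n, n.lt_succ_self, e, o, q, hrun, hq⟩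
    · exact absurd ((hsent x).1 h) hn

theorem exists_packet (hp : p ∉ B) (h : MsgFrom (cfg n).sent p x) (hx : x.Public) (q : Proc f) :
    ∃ k ∈ (cfg n).sent, k.src = p ∧ k.dst = q ∧ k.msg = x := by
  obtain ⟨i, hi, e, o, q', hrun, hq'⟩ := hexec.exists_runsAt_of_msgFrom_sent hp h
  have hq := hrun.transition.mem_out_of_public hx hq' q
  exact ⟨_, hexec.monotone_sent hi (hrun.mem_sent_succ hq), rfl, rfl, rfl⟩

theorem attests_of_agg_sent (hp : p ∉ B) (h : MsgFrom (cfg n).sent p (.agg M sigs t)) :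
    Attests M sigs t := by
  obtain ⟨i, -, e, o, q, hrun, hq⟩ := hexec.exists_runsAt_of_msgFrom_sent hp h
  exact hrun.transition.attests_of_agg_mem_out (hexec.localInv hp i).toCollectionInv hq

theorem agg_sent_of_echo_sent (hp : p ∉ B) (ht : 2 ≤ t)
    (h : MsgFrom (cfg n).sent p (.signed (.echo M t))) :
    ∃ sigs, MsgFrom (cfg n).sent (Fin.ofNat _ t) (.agg M sigs t) := by
  obtain ⟨i, hi, e, o, q, hrun, hq⟩ := hexec.exists_runsAt_of_msgFrom_sent hp h
  obtain ⟨hts, sigs, hagg⟩ := hrun.transition.echo_mem_out hq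
  have hinv := (hexec.localInv hp i).toElectionInv
  have hle := hts.trans_le hinv.ts_le_leTs
  rw [hinv.leader_eq (ht.trans hle), ← hinv.ts_eq_leTs (ht.trans hle), ← hts] at hagg
  exact ⟨sigs, hagg.mono ((hexec.received_subset_sent hp i).trans (hexec.monotone_sent hi.le))⟩

theorem echo_heard_of_ready_sent (hB : B.card ≤ f) (hp : p ∉ B)
    (h : MsgFrom (cfg n).sent p (.signed (.ready M t))) :
    Heard (cfg n).sent (2 * f + 1) (.signed (.echo M t)) := by
  induction n using Nat.strong_induction_on generalizing p with
  | _ n ih =>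
    obtain ⟨i, hi, e, o, q, hrun, hq⟩ := hexec.exists_runsAt_of_msgFrom_sent hp h
    have hsub := hexec.received_subset_sent hp i
    refine Heard.mono ?_ (hexec.monotone_sent hi.le)
    rcases (hrun.transition.ready_mem_out hq).2 with hecho | hready
    · exact hecho.mono hsub
    · obtain ⟨q, hqB, hq⟩ := hready.exists_correct hB
      exact ih i hi hqB (hq.mono hsub)

theorem ready_unique (hB : B.card ≤ f) (hp : p ∉ B) (hq : q ∉ B)
    (h : MsgFrom (cfg n).sent p (.signed (.ready M t)))
    (h' : MsgFrom (cfg n).sent q (.signed (.ready M' t))) : M = M' := by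
  obtain ⟨r, hr, hM, hM'⟩ := (hexec.echo_heard_of_ready_sent hB hp h).exists_correct_common hB
    (hexec.echo_heard_of_ready_sent hB hq h')
  exact (hexec.castInv_echo hr n).unique M M' t hM hM'

theorem exists_runsAt_change (hp : p ∉ B) (ht : 1 ≤ t) (hlt : t < ((cfg n).loc p).leTs) :
    ∃ i < n, ∃ e o, RunsAt timeout cfg act time i p e o ∧ ((cfg i).loc p).leTs = t ∧
      ((cfg (i + 1)).loc p).leTs = t + 1 := by
  induction n with
  | zero => simp [hexec.init, LState.init] at hlt; omega
  | succ n ih =>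
    by_cases hn : t < ((cfg n).loc p).leTs
    · obtain ⟨i, hi, hrun⟩ := ih hn
      exact ⟨i, hi.trans n.lt_succ_self, hrun⟩
    rcases hexec.runsAt_or_unchanged hp n with ⟨e, o, hrun⟩ | ⟨hloc, -⟩
    · have hsucc := (hrun.transition.change_of_leTs_lt (hexec.localInv hp n).toElectionInv
        (by omega)).1
      exact ⟨n, n.lt_succ_self, e, o, hrun, by omega, by omega⟩
    · exact absurd (hloc ▸ hlt) hn

theorem complaint_heard (hp : p ∉ B) (ht : 1 ≤ t) (hlt : t < ((cfg n).loc p).leTs) :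
    Heard ((cfg n).loc p).received (2 * f + 1) (.complaint t) := by
  obtain ⟨i, hi, e, o, hrun, rfl, hsucc⟩ := hexec.exists_runsAt_change hp ht hlt
  exact (hrun.transition.change_of_leTs_lt (hexec.localInv hp i).toElectionInv (by omega)).2.1.mono
    (hexec.monotone_received hp hi.le)

end IsExecution

/-! ### Time and message delays -/

/-- At some time, no handler of `p` is enabled in the state `s`. -/
def Settled (timeout : ℕ → ℝ) (p : Proc f) (s : LState f V) : Prop :=
  ∃ now, ∀ e : Event f V, e.Internal → ¬ ∃ s' o, LocalStep timeout now p s e s' o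

namespace Settled

variable {timeout : ℕ → ℝ} {p q : Proc f} {s : LState f V} {M : Finset V}
  {sigs : Finset (Sig f V)} {a t : ℕ}

theorem le_card_leC (h : Settled timeout p s) (hs : HandledInv s)
    (hx : Heard s.received a (.complaint s.leTs)) : a ≤ s.leC.card := by
  obtain ⟨now, h⟩ := h
  obtain ⟨Q, hQ, hx⟩ := hx
  refine hQ.trans (Finset.card_le_card fun q hq => ?_)
  obtain ⟨k, hk, rfl, hmsg⟩ := hx q hq
  by_contra hq
  have hpending : k ∉ s.handled := fun hk => hq ((hs.complaint k hk _ hmsg).2 rfl)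
  exact h (.complaint k) trivial ⟨_, _, .complaint k ⟨hk, hpending⟩ hmsg⟩

theorem leComplained (h : Settled timeout p s) (hs : LocalInv s)
    (hx : Heard s.received (f + 1) (.complaint s.leTs)) : s.leComplained :=
  hs.leComplained_of_card (h.le_card_leC hs.toHandledInv hx)

theorem not_heard_complaint (h : Settled timeout p s) (hs : LocalInv s) :
    ¬ Heard s.received (2 * f + 1) (.complaint s.leTs) := fun hx => by
  have := h.le_card_leC hs.toHandledInv hx
  have := hs.card_leC_le
  omega

theorem mem_q_of_contrib (h : Settled timeout p s) (hs : HandledInv s) (hp : p = s.leader) {m : V}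
    (hx : MsgFrom s.received q (.signed (.contrib m s.ts))) : q ∈ s.q := by
  obtain ⟨now, h⟩ := h
  obtain ⟨k, hk, rfl, hmsg⟩ := hx
  by_contra hq
  have hpending : k ∉ s.handled := fun hk => hq ((hs.contrib k hk _ _ hmsg).2 rfl)
  exact h (.contribution k) trivial ⟨_, _, .contribution k m ⟨hk, hpending⟩ hmsg hp⟩

theorem mem_handled_of_valid (h : Settled timeout p s) (hp : p = s.leader) {k : Packet f V}
    (hk : k ∈ s.received) (hmsg : k.msg = .valid M sigs t) (hcert : VoteCert M sigs t) :
    k ∈ s.handled := by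
  obtain ⟨now, h⟩ := h
  by_contra hpending
  exact h (.validSet k) trivial ⟨_, _, .validSet k M sigs t ⟨hk, hpending⟩ hmsg hp hcert⟩

theorem proposed (h : Settled timeout p s) (hq : 2 * f + 1 ≤ s.q.card) : s.proposed := by
  obtain ⟨now, h⟩ := h
  by_contra hnew
  exact h .propose trivial ⟨_, _, .propose hq hnew⟩

theorem echoed (h : Settled timeout p s) (hs : HandledInv s)
    (hx : MsgFrom s.received s.leader (.agg M sigs s.ts)) (hatt : Attests M sigs s.ts) :
    s.echoed := by
  obtain ⟨now, h⟩ := h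
  obtain ⟨k, hk, hsrc, hmsg⟩ := hx
  by_contra hnew
  have hpending : k ∉ s.handled := fun hk => hnew ((hs.agg k hk _ _ _ hmsg).2 rfl)
  exact h (.aggregation k) trivial
    ⟨_, _, .aggregation k M sigs ⟨hk, hpending⟩ hmsg hsrc hnew hatt⟩

theorem readied_of_echo (h : Settled timeout p s)
    (hx : Heard s.received (2 * f + 1) (.signed (.echo M s.ts))) : s.readied := by
  obtain ⟨now, h⟩ := h
  by_contra hnew
  exact h (.echoQuorum M) trivial ⟨_, _, .echoQuorum M (LState.le_card_senders_iff.2 hx) hnew⟩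

theorem readied_of_ready (h : Settled timeout p s)
    (hx : Heard s.received (f + 1) (.signed (.ready M s.ts))) : s.readied := by
  obtain ⟨now, h⟩ := h
  by_contra hnew
  exact h (.readyAmplify M) trivial ⟨_, _, .readyAmplify M (LState.le_card_senders_iff.2 hx) hnew⟩

theorem delivered (h : Settled timeout p s)
    (hx : Heard s.received (2 * f + 1) (.signed (.ready M s.ts))) : s.delivered := by
  obtain ⟨now, h⟩ := h
  by_contra hnew
  exact h (.deliver M) trivial ⟨_, _, .deliver M (LState.le_card_senders_iff.2 hx) hnew⟩

end Settled

/-- The number of steps up to and including time `x`. -/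
noncomputable def stepsUntil (time : ℕ → ℝ) (x : ℝ) : ℕ := sInf {n | x < time n}

/-- The configuration after all steps up to and including time `x`. -/
noncomputable def configAt (cfg : ℕ → Config f V) (time : ℕ → ℝ) (x : ℝ) : Config f V :=
  cfg (stepsUntil time x)

namespace IsExecution

variable {timeout : ℕ → ℝ} {B : Finset (Proc f)} {p₀ : Proc f} {gst δ : ℝ}
  {cfg : ℕ → Config f V} {act : ℕ → Action f V} {time : ℕ → ℝ}
  (hexec : IsExecution timeout B p₀ gst δ cfg act time)
  {n a : ℕ} {p q : Proc f} {w : Msg f V} {k : Packet f V} {x y d : ℝ}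

include hexec

theorem lt_stepsUntil : n < stepsUntil time x ↔ time n ≤ x := by
  refine ⟨fun h => not_lt.1 (Nat.notMem_of_lt_sInf h), fun h => ?_⟩
  have hmem : x < time (stepsUntil time x) :=
    Nat.sInf_mem (hexec.time_unbounded.eventually_gt_atTop x).exists
  by_contra! hle
  exact (hmem.trans_le (hexec.time_mono hle)).not_ge h

theorem stepsUntil_mono (h : y ≤ x) : stepsUntil time y ≤ stepsUntil time x :=
  le_of_forall_lt fun _ hn => hexec.lt_stepsUntil.2 ((hexec.lt_stepsUntil.1 hn).trans h)

theorem settled_and_lt_deadline (hp : p ∉ B) (hx : 0 ≤ x) :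
    Settled timeout p ((configAt cfg time x).loc p) ∧
      ∀ d, ((configAt cfg time x).loc p).deadline = some d → x < d := by
  obtain ⟨n, hn⟩ := Nat.exists_eq_succ_of_ne_zero
    (hexec.lt_stepsUntil.2 (hexec.time_zero.trans_le hx)).ne'
  have hle : time n ≤ x := hexec.lt_stepsUntil.1 (by omega)
  have hlt : x < time (n + 1) := by
    rw [← not_le, ← hexec.lt_stepsUntil]
    omega
  rw [configAt, hn]
  have hurgent := hexec.urgent n (hle.trans_lt hlt) p hp
  refine ⟨⟨time n, hurgent⟩, fun d hd => ?_⟩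
  have hnow : time n < d := by
    by_contra! hnow
    exact hurgent .timeout trivial ⟨_, _, .timeout d hd hnow⟩
  exact hlt.trans_le ((hexec.timer n p hp d hd).trans (max_le hnow.le le_rfl))

theorem settled (hp : p ∉ B) (hx : 0 ≤ x) : Settled timeout p ((configAt cfg time x).loc p) :=
  (hexec.settled_and_lt_deadline hp hx).1

theorem lt_deadline (hp : p ∉ B) (hx : 0 ≤ x)
    (hd : ((configAt cfg time x).loc p).deadline = some d) : x < d :=
  (hexec.settled_and_lt_deadline hp hx).2 d hd

theorem mem_received (hsrc : k.src ∉ B) (hdst : k.dst ∉ B) (hk : k ∈ (configAt cfg time y).sent)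
    (hyx : y + δ ≤ x) (hgst : gst + δ ≤ x) :
    k ∈ ((configAt cfg time x).loc k.dst).received := by
  obtain ⟨j, hj, htime⟩ := hexec.synchrony _ k hk hsrc hdst
  have hid : time k.id ≤ y := hexec.lt_stepsUntil.1 (hexec.id_lt hk)
  have hjx : time j ≤ x := htime.trans (by rw [max_add]; exact max_le (by linarith) hgst)
  refine hexec.monotone_received hdst (Nat.succ_le_of_lt (hexec.lt_stepsUntil.2 hjx)) ?_
  obtain ⟨-, o, hrun⟩ := hexec.exists_runsAt hj
  exact hrun.localStep.mem_received

theorem msgFrom_received (hp : p ∉ B) (hq : q ∉ B) (h : MsgFrom (configAt cfg time y).sent p w)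
    (hw : w.Public) (hyx : y + δ ≤ x) (hgst : gst + δ ≤ x) :
    MsgFrom ((configAt cfg time x).loc q).received p w := by
  obtain ⟨k, hk, rfl, rfl, rfl⟩ := hexec.exists_packet hp h hw q
  exact ⟨k, hexec.mem_received hp hq hk hyx hgst, rfl, rfl⟩

theorem heard_received (hB : B.card ≤ f) (hq : q ∉ B)
    (h : Heard (configAt cfg time y).sent (a + f) w) (hw : w.Public) (hyx : y + δ ≤ x)
    (hgst : gst + δ ≤ x) : Heard ((configAt cfg time x).loc q).received a w :=
  h.of_add hB fun _ hp hpw => hexec.msgFrom_received hp hq hpw hw hyx hgst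

theorem heard_received_of_forall (hB : B.card ≤ f) (hq : q ∉ B)
    (h : ∀ p ∉ B, MsgFrom (configAt cfg time y).sent p w) (hw : w.Public) (hyx : y + δ ≤ x)
    (hgst : gst + δ ≤ x) : Heard ((configAt cfg time x).loc q).received (2 * f + 1) w :=
  .of_correct hB fun p hp => hexec.msgFrom_received hp hq (h p hp) hw hyx hgst

end IsExecution

/-! ### Terms -/

/-- In `c`, every correct process has an election timestamp of at least `T`. -/
def Reached (B : Finset (Proc f)) (c : Config f V) (T : ℕ) : Prop :=
  ∀ p ∉ B, T ≤ (c.loc p).leTs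

/-- In `c`, every correct process has the election timestamp `T`. -/
def InTerm (B : Finset (Proc f)) (c : Config f V) (T : ℕ) : Prop :=
  ∀ p ∉ B, (c.loc p).leTs = T

/-- Some correct process ever has an election timestamp of at least `T`. -/
def Entered (B : Finset (Proc f)) (cfg : ℕ → Config f V) (T : ℕ) : Prop :=
  ∃ n, ∃ p ∉ B, T ≤ ((cfg n).loc p).leTs

/-- The step that first moves a correct process to an election timestamp of at least `T`. -/
noncomputable def entryStep (B : Finset (Proc f)) (cfg : ℕ → Config f V) (T : ℕ) : ℕ :=
  sInf {n | ∃ p ∉ B, T ≤ ((cfg (n + 1)).loc p).leTs}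

/-- The time at which the first correct process moves to an election timestamp of at least `T`. -/
noncomputable def entryTime (B : Finset (Proc f)) (cfg : ℕ → Config f V) (time : ℕ → ℝ) (T : ℕ) :
    ℝ :=
  time (entryStep B cfg T)

namespace IsExecution

variable {timeout : ℕ → ℝ} {B : Finset (Proc f)} {p₀ : Proc f} {gst δ : ℝ}
  {cfg : ℕ → Config f V} {act : ℕ → Action f V} {time : ℕ → ℝ}
  (hexec : IsExecution timeout B p₀ gst δ cfg act time)
  {n T : ℕ} {p q : Proc f} {x y z d : ℝ}

include hexec

theorem tendsto_stepsUntil : Tendsto (stepsUntil time) atTop atTop :=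
  tendsto_atTop.2 fun n =>
    (eventually_ge_atTop (time n)).mono fun _ hx => (hexec.lt_stepsUntil.2 hx).le

theorem reached_mono (h : Reached B (configAt cfg time y) T) (hyx : y ≤ x) :
    Reached B (configAt cfg time x) T :=
  fun p hp => (h p hp).trans (hexec.monotone_leTs hp (hexec.stepsUntil_mono hyx))

theorem reached_one (c : ℕ) : Reached B (cfg c) 1 :=
  fun _ hp => (hexec.localInv hp c).one_le_leTs

theorem complaint_sent_of_reached (hB : B.card ≤ f) (hz : 0 ≤ z) (hT : 1 ≤ T) (hp : p ∉ B)
    (hlt : T < ((configAt cfg time y).loc p).leTs) (hyz : y + δ ≤ z) (hgst : gst + δ ≤ z)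
    (hreached : Reached B (configAt cfg time z) T) (hq : q ∉ B) :
    MsgFrom (configAt cfg time z).sent q (.complaint T) := by
  have hcomplaint := hexec.complaintInv hq (stepsUntil time z)
  rcases (hreached q hq).lt_or_eq with hlt' | rfl
  · exact hcomplaint.earlier T hT hlt'
  · refine hcomplaint.current ((hexec.settled hq hz).leComplained (hexec.localInv hq _) ?_)
    refine hexec.heard_received (y := y) hB hq (Heard.of_le (b := 2 * f + 1) ?_ (by omega))
      trivial hyz hgst
    exact (hexec.complaint_heard hp hT hlt).mono (hexec.received_subset_sent hp _)

theorem reached_succ (hB : B.card ≤ f) (hδ : 0 ≤ δ) (hz : 0 ≤ z) (hT : 1 ≤ T) (hp : p ∉ B)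
    (hlt : T < ((configAt cfg time y).loc p).leTs) (hyz : y + δ ≤ z) (hgst : gst + δ ≤ z)
    (hreached : Reached B (configAt cfg time z) T) :
    Reached B (configAt cfg time (z + δ)) (T + 1) := by
  intro q hq
  have hle := hexec.reached_mono hreached (show z ≤ z + δ by linarith) q hq
  refine lt_of_le_of_ne hle fun heq => ?_
  refine (hexec.settled (x := z + δ) hq (by linarith)).not_heard_complaint (hexec.localInv hq _) ?_
  rw [← heq]
  exact hexec.heard_received_of_forall hB hq
    (fun r hr => hexec.complaint_sent_of_reached hB hz hT hp hlt hyz hgst hreached hr) trivial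
    le_rfl (by linarith)

theorem eventually_reached (hB : B.card ≤ f) (hδ : 0 ≤ δ) (hT : Entered B cfg T) :
    ∀ᶠ x in atTop, Reached B (configAt cfg time x) T := by
  obtain ⟨n, p, hp, hn⟩ := hT
  induction T with
  | zero => exact .of_forall fun _ _ _ => Nat.zero_le _
  | succ T ih =>
    rcases Nat.eq_zero_or_pos T with rfl | hT
    · exact .of_forall fun x => hexec.reached_one _
    obtain ⟨y, hy⟩ := (hexec.tendsto_stepsUntil.eventually_ge_atTop n).exists
    have hlt := hn.trans (hexec.monotone_leTs hp hy)
    obtain ⟨z, hreached, hz, hyz, hgst⟩ := ((ih (Nat.le_of_succ_le hn)).and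
      ((eventually_ge_atTop 0).and ((eventually_ge_atTop (y + δ)).and
        (eventually_ge_atTop (gst + δ))))).exists
    have := hexec.reached_succ hB hδ hz hT hp hlt hyz hgst hreached
    exact (eventually_ge_atTop _).mono fun x => hexec.reached_mono this

theorem ts_eq_ts_of_inTerm (hy : InTerm B (configAt cfg time y) T)
    (hx : InTerm B (configAt cfg time x) T) (hq : q ∉ B) (hp : p ∉ B) :
    ((configAt cfg time y).loc q).ts = ((configAt cfg time x).loc p).ts := by
  unfold configAt at *
  rw [(hexec.localInv hq _).ts_eq, (hexec.localInv hp _).ts_eq, hy q hq, hx p hp]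

theorem delivered_of_readied (hB : B.card ≤ f) (hy : InTerm B (configAt cfg time y) T)
    (hx : InTerm B (configAt cfg time x) T) (hx0 : 0 ≤ x) (hyx : y + δ ≤ x) (hgst : gst + δ ≤ x)
    (hready : ∀ q ∉ B, ((configAt cfg time y).loc q).readied) (hp : p ∉ B) :
    ((configAt cfg time x).loc p).delivered := by
  obtain ⟨M, hM⟩ := (hexec.castInv_ready hp (stepsUntil time y)).exists_sent (hready p hp)
  refine (hexec.settled hp hx0).delivered (M := M)
    (hexec.heard_received_of_forall (y := y) hB hp (fun q hq => ?_) trivial hyx hgst)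
  obtain ⟨M', hM'⟩ := (hexec.castInv_ready hq _).exists_sent (hready q hq)
  have hts (q) (hq : q ∉ B) := hexec.ts_eq_ts_of_inTerm hy hx hq hp
  rw [configAt] at hts
  rw [hts q hq] at hM'
  rw [hts p hp] at hM
  rwa [hexec.ready_unique hB hp hq hM hM']

theorem entryStep_lt (hT : 2 ≤ T) (hp : p ∉ B) (h : T ≤ ((cfg n).loc p).leTs) :
    entryStep B cfg T < n := by
  cases n with
  | zero => simp [hexec.init, LState.init] at h; omega
  | succ n => exact Nat.lt_succ_of_le (Nat.sInf_le ⟨p, hp, h⟩)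

theorem exists_le_leTs_entryStep (hT : 2 ≤ T) (h : Entered B cfg T) :
    ∃ p ∉ B, T ≤ ((cfg (entryStep B cfg T + 1)).loc p).leTs := by
  obtain ⟨n, p, hp, hn⟩ := h
  refine Nat.sInf_mem (s := {n | ∃ p ∉ B, T ≤ ((cfg (n + 1)).loc p).leTs}) ?_
  cases n with
  | zero => simp [hexec.init, LState.init] at hn; omega
  | succ n => exact ⟨n, p, hp, hn⟩

theorem entryTime_add_timeout_le_deadline (hT : 2 ≤ T) (hp : p ∉ B)
    (hn : ((cfg n).loc p).leTs = T) (hd : ((cfg n).loc p).deadline = some d) :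
    entryTime B cfg time T + timeout T ≤ d := by
  induction n with
  | zero => simp [hexec.init, LState.init] at hn; omega
  | succ n ih =>
    have hentry := hexec.entryStep_lt hT hp hn.ge
    have hts := (hexec.localInv hp (n + 1)).ts_eq_leTs (hT.trans_eq hn.symm)
    rcases hexec.runsAt_or_unchanged hp n with ⟨e, o, hrun⟩ | ⟨hloc, -⟩
    · rcases hrun.transition.deadline_eq with h | ⟨h, hle⟩ | ⟨h, -⟩
      · simp [h] at hd
      · exact ih (hle ▸ hn) (h ▸ hd)
      · rw [h, hts, hn, Option.some_inj] at hd
        have := hexec.time_mono (Nat.le_of_lt_succ hentry)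
        rw [entryTime]
        linarith
    · exact ih (hloc ▸ hn) (hloc ▸ hd)

theorem entryTime_add_timeout_le_of_complaint (hB : B.card ≤ f) (hT : 2 ≤ T) (hp : p ∉ B)
    (h : MsgFrom (cfg n).sent p (.complaint T)) :
    ∃ i < n, entryTime B cfg time T + timeout T ≤ time i := by
  induction n using Nat.strong_induction_on generalizing p with
  | _ n ih =>
    obtain ⟨i, hi, e, o, q, hrun, hq⟩ := hexec.exists_runsAt_of_msgFrom_sent hp h
    obtain ⟨rfl, ⟨d, hd, hnow⟩ | hheard⟩ :=
      hrun.transition.complaint_mem_out (hexec.localInv hp i).toElectionInv hq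
    · exact ⟨i, hi, (hexec.entryTime_add_timeout_le_deadline hT hp rfl hd).trans hnow⟩
    · obtain ⟨q, hqB, hq⟩ := hheard.exists_correct hB
      obtain ⟨j, hj, hle⟩ := ih i hi hqB (hq.mono (hexec.received_subset_sent hp i))
      exact ⟨j, hj.trans hi, hle⟩

theorem entryTime_add_timeout_le_of_lt_leTs (hB : B.card ≤ f) (hT : 2 ≤ T) (hp : p ∉ B)
    (h : T < ((cfg n).loc p).leTs) : ∃ i < n, entryTime B cfg time T + timeout T ≤ time i := by
  obtain ⟨q, hq, hcomplaint⟩ := Heard.exists_correct hB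
    ((hexec.complaint_heard hp (by omega) h).of_le (show f + 1 ≤ 2 * f + 1 by omega))
  exact hexec.entryTime_add_timeout_le_of_complaint hB hT hq
    (hcomplaint.mono (hexec.received_subset_sent hp n))

theorem inTerm_of_reached (hB : B.card ≤ f) (hT : 2 ≤ T)
    (h : Reached B (configAt cfg time x) T) (hx : x < entryTime B cfg time T + timeout T) :
    InTerm B (configAt cfg time x) T := by
  refine fun p hp => (h p hp).antisymm' (not_lt.1 fun hlt => ?_)
  obtain ⟨i, hi, hle⟩ := hexec.entryTime_add_timeout_le_of_lt_leTs hB hT hp hlt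
  exact (hle.trans (hexec.lt_stepsUntil.1 hi)).not_gt hx

theorem entryTime_add_timeout_le (hB : B.card ≤ f) (hT : 2 ≤ T) (h : Entered B cfg (T + 1)) :
    entryTime B cfg time T + timeout T ≤ entryTime B cfg time (T + 1) := by
  obtain ⟨p, hp, hle⟩ := hexec.exists_le_leTs_entryStep (by omega) h
  obtain ⟨i, hi, hle⟩ := hexec.entryTime_add_timeout_le_of_lt_leTs hB hT hp hle
  exact hle.trans (hexec.time_mono (Nat.le_of_lt_succ hi))

end IsExecution

/-! ### Finitely many changes of leader -/

namespace IsExecution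

variable {timeout : ℕ → ℝ} {B : Finset (Proc f)} {p₀ : Proc f} {gst δ : ℝ}
  {cfg : ℕ → Config f V} {act : ℕ → Action f V} {time : ℕ → ℝ}
  (hexec : IsExecution timeout B p₀ gst δ cfg act time)
  {T : ℕ} {p q : Proc f} {x y : ℝ} {M : Finset V}

include hexec

theorem eventually_inTerm (hB : B.card ≤ f) (hδ : 0 ≤ δ) (hT : Entered B cfg T)
    (hlast : ¬ Entered B cfg (T + 1)) : ∀ᶠ n in atTop, InTerm B (cfg n) T := by
  obtain ⟨x, hx⟩ := (hexec.eventually_reached hB hδ hT).exists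
  refine (eventually_ge_atTop (stepsUntil time x)).mono fun n hn p hp => le_antisymm ?_ ?_
  · exact Nat.le_of_lt_succ (not_le.1 fun hle => hlast ⟨n, p, hp, hle⟩)
  · exact (hx p hp).trans (hexec.monotone_leTs hp hn)

theorem exists_eventually_inTerm (hB : B.card ≤ f) (hδ : 0 ≤ δ) (h : ¬ ∀ T, Entered B cfg T) :
    ∃ T, ∀ᶠ n in atTop, InTerm B (cfg n) T := by
  by_contra hterm
  refine h fun T => ?_
  induction T with
  | zero =>
    obtain ⟨p, hp⟩ := exists_correct hB
    exact ⟨0, p, hp, Nat.zero_le _⟩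
  | succ T ih => exact by_contra fun hlast => hterm ⟨T, hexec.eventually_inTerm hB hδ ih hlast⟩

theorem eventually_myM_ne_none (hp : p ∉ B) (h : Broadcasts act p) :
    ∀ᶠ n in atTop, ((cfg n).loc p).myM ≠ none := by
  obtain ⟨n, m, hn⟩ := h
  obtain ⟨-, o, hrun⟩ := hexec.exists_runsAt hn
  refine (eventually_ge_atTop (n + 1)).mono fun i hi => hexec.myM_ne_none hp ?_ hi
  have hstep := hrun.localStep
  generalize cfg (n + 1) = c at hstep ⊢
  generalize c.loc p = s at hstep ⊢
  cases hstep
  exact Option.some_ne_none m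

theorem eventually_deadline_eq_none (hp : p ∉ B) (hbroadcast : Broadcasts act p)
    (hterm : ∀ᶠ n in atTop, InTerm B (cfg n) T) :
    ∀ᶠ x in atTop, ((configAt cfg time x).loc p).deadline = none := by
  obtain ⟨m, hm⟩ := eventually_atTop.1 (hterm.and (hexec.eventually_myM_ne_none hp hbroadcast))
  have hdeadline (n) (hn : m ≤ n) :
      ((cfg n).loc p).deadline = none ∨ ((cfg n).loc p).deadline = ((cfg m).loc p).deadline := by
    induction n, hn using Nat.le_induction with
    | base => exact .inr rfl
    | succ n hn ih =>
      rcases hexec.runsAt_or_unchanged hp n with ⟨e, o, hrun⟩ | ⟨hloc, -⟩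
      · rcases hrun.transition.deadline_eq with h | ⟨h, -⟩ | ⟨-, h | h⟩
        · exact .inl h
        · rwa [h]
        · exact absurd h (hm n hn).2
        · rw [(hm n hn).1 p hp, (hm (n + 1) (hn.trans n.le_succ)).1 p hp] at h
          exact absurd h (lt_irrefl T)
      · rwa [hloc]
  have hexpired : ∀ᶠ x in atTop, ∀ d ∈ ((cfg m).loc p).deadline, d ≤ x := by
    cases ((cfg m).loc p).deadline with
    | none => simp
    | some d => simpa using eventually_ge_atTop d
  filter_upwards [hexpired, eventually_ge_atTop 0, hexec.tendsto_stepsUntil.eventually_ge_atTop m]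
    with x hexpired hx0 hmx
  rcases hdeadline _ hmx with h | h
  · exact h
  · refine Option.eq_none_iff_forall_ne_some.2 fun d hd => ?_
    exact (hexec.lt_deadline hp hx0 hd).not_ge (hexpired d (h ▸ hd))

theorem exists_ready_quorum (hB : B.card ≤ f) (hy : InTerm B (configAt cfg time y) T)
    (hx : InTerm B (configAt cfg time x) T) (hx0 : 0 ≤ x) (hyx : y + δ ≤ x) (hgst : gst + δ ≤ x)
    (htimer : ∀ p ∉ B, ((configAt cfg time y).loc p).deadline = none) :
    ∃ p ∉ B, ∃ M, Heard ((configAt cfg time y).loc p).received (2 * f + 1)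
      (.signed (.ready M ((configAt cfg time y).loc p).ts)) := by
  by_contra! hready
  have hcomplained (p) (hp : p ∉ B) : MsgFrom (configAt cfg time y).sent p (.complaint T) := by
    rw [← hy p hp]
    refine (hexec.complaintInv hp _).current ?_
    exact ((hexec.localInv hp _).timer (htimer p hp)).resolve_right (not_exists.2 (hready p hp))
  obtain ⟨p, hp⟩ := exists_correct hB
  refine (hexec.settled hp hx0).not_heard_complaint (hexec.localInv hp _) ?_
  rw [hx p hp]
  exact hexec.heard_received_of_forall hB hp hcomplained trivial hyx hgst

theorem readied_of_ready_quorum (hB : B.card ≤ f) (hy : InTerm B (configAt cfg time y) T)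
    (hx : InTerm B (configAt cfg time x) T) (hx0 : 0 ≤ x) (hyx : y + δ ≤ x) (hgst : gst + δ ≤ x)
    (hp : p ∉ B) (hready : Heard ((configAt cfg time y).loc p).received (2 * f + 1)
      (.signed (.ready M ((configAt cfg time y).loc p).ts))) (hq : q ∉ B) :
    ((configAt cfg time x).loc q).readied := by
  refine (hexec.settled hq hx0).readied_of_ready (M := M) ?_
  rw [← hexec.ts_eq_ts_of_inTerm hy hx hp hq]
  refine hexec.heard_received hB hq (y := y) ?_ trivial hyx hgst
  exact (hready.mono (hexec.received_subset_sent hp _)).of_le (by omega)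

theorem exists_delivered_of_eventually_inTerm (hB : B.card ≤ f) (hδ : 0 ≤ δ)
    (hbroadcast : ∀ p ∉ B, Broadcasts act p) (hterm : ∀ᶠ n in atTop, InTerm B (cfg n) T) :
    ∃ x, ∀ p ∉ B, ((configAt cfg time x).loc p).delivered := by
  have htimer : ∀ᶠ x in atTop, ∀ p ∈ Bᶜ, ((configAt cfg time x).loc p).deadline = none :=
    Bᶜ.eventually_all.2 fun p hp =>
      have hp := Finset.mem_compl.1 hp
      hexec.eventually_deadline_eq_none hp (hbroadcast p hp) hterm
  obtain ⟨y, htimer, hterm, hy0, hgst⟩ := (htimer.and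
    ((eventually_forall_ge_atTop.2 (hexec.tendsto_stepsUntil.eventually hterm)).and
      ((eventually_ge_atTop 0).and (eventually_ge_atTop gst)))).exists
  obtain ⟨p, hp, M, hready⟩ := hexec.exists_ready_quorum hB (hterm y le_rfl)
    (hterm (y + δ) (by linarith)) (by linarith) le_rfl (by linarith)
    fun p hp => htimer p (Finset.mem_compl.2 hp)
  have hreadied (q) (hq : q ∉ B) := hexec.readied_of_ready_quorum hB (hterm y le_rfl)
    (hterm (y + δ) (by linarith)) (by linarith) le_rfl (by linarith) hp hready hq
  exact ⟨y + δ + δ, fun q hq => hexec.delivered_of_readied hB (hterm (y + δ) (by linarith))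
    (hterm (y + δ + δ) (by linarith)) (by linarith) le_rfl (by linarith) hreadied hq⟩

end IsExecution

/-! ### A term with a correct leader -/

theorem Transition.mem_q_of_mem_handled {timeout : ℕ → ℝ} {now : ℝ} {p : Proc f}
    {s s' : LState f V} {e : Event f V} {o : Out f V} {k : Packet f V} {M : Finset V}
    {sigs : Finset (Sig f V)} {t T : ℕ} (h : Transition timeout now p s e s' o)
    (hmsg : k.msg = .valid M sigs t) (hlead : k ∈ s.received → p = s.leader → T ≤ s.leTs)
    (hk : k ∈ s.handled → T ≤ s.leTs ∧ (s.leTs = T → k.src ∈ s.q)) :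
    k ∈ s'.handled → T ≤ s'.leTs ∧ (s'.leTs = T → k.src ∈ s'.q) := by
  cases h <;>
    simp only [LState.consume, LState.collect, LState.collectValid, LState.change,
      LState.newLeader] <;> grind

theorem ofNat_succ_ne_of_ne {p q : Proc f} (h : p ≠ q) (t : ℕ) :
    (Fin.ofNat (3 * f + 1) t : Proc f) ≠ Fin.ofNat (3 * f + 1) (t + 1) := by
  intro heq
  have hmod : t ≡ t + 1 [MOD 3 * f + 1] := congrArg Fin.val heq
  have hdvd := (Nat.modEq_iff_dvd' t.le_succ).1 hmod
  have hf : 3 * f + 1 = 1 := Nat.dvd_one.1 (by simpa using hdvd)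
  obtain rfl : f = 0 := by omega
  exact h (Subsingleton.elim (α := Fin 1) p q)

namespace IsExecution

variable {timeout : ℕ → ℝ} {B : Finset (Proc f)} {p₀ : Proc f} {gst δ : ℝ}
  {cfg : ℕ → Config f V} {act : ℕ → Action f V} {time : ℕ → ℝ}
  (hexec : IsExecution timeout B p₀ gst δ cfg act time)
  {i n T : ℕ} {p q : Proc f} {x y : ℝ} {k : Packet f V} {M : Finset V} {sigs : Finset (Sig f V)}

include hexec

/-- Only the leader of term `T + 1` takes a packet sent by a process that enters this term, because
the leader of term `T` is a different process. -/
theorem succ_le_leTs_of_leader (hT : 2 ≤ T) (hp : p ∉ B) (hpT : p = Fin.ofNat _ (T + 1))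
    (hi : Reached B (cfg i) T) (hq : T + 1 ≤ ((cfg (i + 1)).loc q).leTs) (hin : i < n)
    (hlead : p = ((cfg n).loc p).leader) : T + 1 ≤ ((cfg n).loc p).leTs := by
  by_cases hpq : p = q
  · exact hq.trans (hpq ▸ hexec.monotone_leTs hp hin)
  have hle : T ≤ ((cfg n).loc p).leTs := (hi p hp).trans (hexec.monotone_leTs hp hin.le)
  refine hle.lt_of_ne fun heq => ?_
  have hT' := (hexec.localInv hp n).leader_eq (hT.trans_eq heq)
  rw [← heq, ← hlead, hpT] at hT'
  exact ofNat_succ_ne_of_ne hpq T hT'.symm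

theorem mem_q_of_mem_handled (hT : 2 ≤ T) (hp : p ∉ B) (hpT : p = Fin.ofNat _ (T + 1))
    (hk : Reached B (cfg k.id) T) (hsrc : T + 1 ≤ ((cfg (k.id + 1)).loc k.src).leTs) {t : ℕ}
    (hmsg : k.msg = .valid M sigs t) (n : ℕ) (hhandled : k ∈ ((cfg n).loc p).handled) :
    T + 1 ≤ ((cfg n).loc p).leTs ∧ (((cfg n).loc p).leTs = T + 1 → k.src ∈ ((cfg n).loc p).q) := by
  induction n with
  | zero => simp [hexec.init, LState.init] at hhandled
  | succ n ih =>
    rcases hexec.runsAt_or_unchanged hp n with ⟨e, o, hrun⟩ | ⟨hloc, -⟩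
    · refine hrun.transition.mem_q_of_mem_handled hmsg (fun hreceived hlead => ?_) ih hhandled
      exact hexec.succ_le_leTs_of_leader hT hp hpT hk hsrc
        (hexec.id_lt (hexec.received_subset_sent hp n hreceived)) hlead
    · rw [hloc] at hhandled ⊢
      exact ih hhandled

theorem leader_eq_of_inTerm (hT : 2 ≤ T) (hx : InTerm B (configAt cfg time x) T) (hp : p ∉ B) :
    ((configAt cfg time x).loc p).leader = Fin.ofNat _ T :=
  hx p hp ▸ (hexec.localInv hp _).leader_eq (hT.trans_eq (hx p hp).symm)

theorem ts_eq_of_inTerm (hT : 2 ≤ T) (hx : InTerm B (configAt cfg time x) T) (hp : p ∉ B) :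
    ((configAt cfg time x).loc p).ts = T :=
  ((hexec.localInv hp _).ts_eq_leTs (hT.trans_eq (hx p hp).symm)).trans (hx p hp)

theorem exists_newLeaderOut_received (hT : 1 ≤ T) (hp : p ∉ B) (hpT : p = Fin.ofNat _ (T + 1))
    (hq : q ∉ B) (hy : T < ((configAt cfg time y).loc q).leTs) (hyx : y + δ ≤ x)
    (hgst : gst + δ ≤ x) :
    ∃ i, entryStep B cfg (T + 1) ≤ i ∧ T + 1 ≤ ((cfg (i + 1)).loc q).leTs ∧
      ∀ w, (p, w) ∈ ((cfg i).loc q).newLeaderOut p (T + 1) →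
        ⟨i, q, p, w⟩ ∈ ((configAt cfg time x).loc p).received := by
  subst hpT
  obtain ⟨i, hi, e, o, hrun, rfl, hsucc⟩ := hexec.exists_runsAt_change hq hT hy
  refine ⟨i, Nat.le_of_lt_succ (hexec.entryStep_lt (by omega) hq hsucc.ge), hsucc.ge,
    fun w hw => hexec.mem_received (k := ⟨i, q, _, w⟩) hq hp ?_ hyx hgst⟩
  have hout := (hrun.transition.change_of_leTs_lt (hexec.localInv hq i).toElectionInv
    (by omega)).2.2
  exact hexec.monotone_sent hi (hrun.mem_sent_succ (hout hw))

theorem mem_q_of_inTerm (hT : 2 ≤ T) (hp : p ∉ B) (hpT : p = Fin.ofNat _ (T + 1))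
    (hentry : Reached B (cfg (entryStep B cfg (T + 1))) T) (hq : q ∉ B)
    (hmyM : ((cfg (entryStep B cfg (T + 1))).loc q).myM ≠ none)
    (hy : InTerm B (configAt cfg time y) (T + 1)) (hx : InTerm B (configAt cfg time x) (T + 1))
    (hx0 : 0 ≤ x) (hyx : y + δ ≤ x) (hgst : gst + δ ≤ x) :
    q ∈ ((configAt cfg time x).loc p).q := by
  obtain ⟨i, hi, hsrc, hreceived⟩ :=
    hexec.exists_newLeaderOut_received (by omega) hp hpT hq (hy q hq).ge hyx hgst
  have hsettled := hexec.settled hp hx0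
  have hlead := (hexec.leader_eq_of_inTerm (by omega) hx hp).trans hpT.symm
  cases hvalid : ((cfg i).loc q).valid with
  | some v =>
    have hk := hreceived (.valid v.1 v.2.1 v.2.2) (by simp [LState.newLeaderOut, hvalid])
    have hhandled := hsettled.mem_handled_of_valid hlead.symm hk rfl
      ((hexec.localInv hq i).voteCert_valid v hvalid)
    exact (hexec.mem_q_of_mem_handled hT hp hpT
      (fun r hr => (hentry r hr).trans (hexec.monotone_leTs hr hi)) hsrc rfl _ hhandled).2 (hx p hp)
  | none =>
    obtain ⟨m, hm⟩ := Option.ne_none_iff_exists'.1 (hexec.myM_ne_none hq hmyM hi)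
    have hk := hreceived (.signed (.contrib m (T + 1))) (by simp [LState.newLeaderOut, hvalid, hm])
    refine hsettled.mem_q_of_contrib (hexec.localInv hp _).toHandledInv hlead.symm (m := m) ?_
    rw [hexec.ts_eq_of_inTerm (by omega) hx hp]
    exact ⟨_, hk, rfl, rfl⟩

theorem proposed_of_inTerm (hB : B.card ≤ f) (hT : 2 ≤ T) (hp : p ∉ B)
    (hpT : p = Fin.ofNat _ (T + 1)) (hentry : Reached B (cfg (entryStep B cfg (T + 1))) T)
    (hmyM : ∀ q ∉ B, ((cfg (entryStep B cfg (T + 1))).loc q).myM ≠ none)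
    (hy : InTerm B (configAt cfg time y) (T + 1)) (hx : InTerm B (configAt cfg time x) (T + 1))
    (hx0 : 0 ≤ x) (hyx : y + δ ≤ x) (hgst : gst + δ ≤ x) :
    ((configAt cfg time x).loc p).proposed := by
  refine (hexec.settled hp hx0).proposed
    ((Nat.succ_le_of_lt (two_mul_lt_card_compl hB)).trans (Finset.card_le_card fun q hq => ?_))
  have hq := Finset.mem_compl.1 hq
  exact hexec.mem_q_of_inTerm hT hp hpT hentry hq (hmyM q hq) hy hx hx0 hyx hgst

theorem exists_echo_sent_of_proposed (hT : 2 ≤ T) (hp : p ∉ B) (hpT : p = Fin.ofNat _ T)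
    (hy : InTerm B (configAt cfg time y) T) (hx : InTerm B (configAt cfg time x) T)
    (hx0 : 0 ≤ x) (hδ : 0 ≤ δ) (hyx : y + δ ≤ x) (hgst : gst + δ ≤ x)
    (hproposed : ((configAt cfg time y).loc p).proposed) :
    ∃ M, ∀ q ∉ B, MsgFrom (configAt cfg time x).sent q (.signed (.echo M T)) := by
  obtain ⟨⟨M, sigs⟩, hagg⟩ := (hexec.castInv_agg hp (stepsUntil time y)).exists_sent hproposed
  change MsgFrom (configAt cfg time y).sent p (.agg M sigs ((configAt cfg time y).loc p).ts) at hagg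
  rw [hexec.ts_eq_of_inTerm hT hy hp] at hagg
  refine ⟨M, fun q hq => ?_⟩
  have hechoed : ((configAt cfg time x).loc q).echoed := by
    have hts := hexec.ts_eq_of_inTerm hT hx hq
    refine (hexec.settled hq hx0).echoed (hexec.localInv hq _).toHandledInv (M := M) (sigs := sigs)
      ?_ (hts ▸ hexec.attests_of_agg_sent hp hagg)
    rw [hts, hexec.leader_eq_of_inTerm hT hx hq, ← hpT]
    exact hexec.msgFrom_received hp hq hagg trivial hyx hgst
  obtain ⟨M', hecho⟩ := (hexec.castInv_echo hq (stepsUntil time x)).exists_sent hechoed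
  change MsgFrom (configAt cfg time x).sent q
    (.signed (.echo M' ((configAt cfg time x).loc q).ts)) at hecho
  rw [hexec.ts_eq_of_inTerm hT hx hq] at hecho
  obtain ⟨sigs', hagg'⟩ := hexec.agg_sent_of_echo_sent hq hT hecho
  have hsub := hexec.monotone_sent (hexec.stepsUntil_mono (show y ≤ x by linarith))
  obtain ⟨rfl, -⟩ := Prod.mk.inj ((hexec.castInv_agg hp _).unique (M, sigs) (M', sigs') T
    (hagg.mono hsub) (hpT ▸ hagg'))
  exact hecho

theorem readied_of_echo_sent (hB : B.card ≤ f) (hT : 2 ≤ T)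
    (hx : InTerm B (configAt cfg time x) T) (hx0 : 0 ≤ x) (hyx : y + δ ≤ x) (hgst : gst + δ ≤ x)
    (hecho : ∀ q ∉ B, MsgFrom (configAt cfg time y).sent q (.signed (.echo M T))) (hq : q ∉ B) :
    ((configAt cfg time x).loc q).readied := by
  refine (hexec.settled hq hx0).readied_of_echo (M := M) ?_
  rw [hexec.ts_eq_of_inTerm hT hx hq]
  exact hexec.heard_received_of_forall hB hq hecho trivial hyx hgst

theorem delivered_of_correct_leader (hB : B.card ≤ f) (hδ : 0 ≤ δ) (hT : 2 ≤ T)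
    (hleader : Fin.ofNat _ (T + 1) ∉ B) (hentry : Reached B (cfg (entryStep B cfg (T + 1))) T)
    (hmyM : ∀ q ∉ B, ((cfg (entryStep B cfg (T + 1))).loc q).myM ≠ none)
    (hgst : gst ≤ entryTime B cfg time (T + 1)) (htimeout : 6 * δ < timeout (T + 1))
    (hreached : Reached B (configAt cfg time (entryTime B cfg time (T + 1) + 2 * δ)) (T + 1))
    (hp : p ∉ B) :
    ((configAt cfg time (entryTime B cfg time (T + 1) + 6 * δ)).loc p).delivered := by
  set a := entryTime B cfg time (T + 1)
  have ha0 : 0 ≤ a := hexec.time_zero.symm.trans_le (hexec.time_mono (Nat.zero_le _))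
  have hterm (x) (hx : a + 2 * δ ≤ x) (hx' : x ≤ a + 6 * δ) :
      InTerm B (configAt cfg time x) (T + 1) :=
    hexec.inTerm_of_reached hB (by omega) (hexec.reached_mono hreached hx) (by linarith)
  have h2 := hterm (a + 2 * δ) (by linarith) (by linarith)
  have h3 := hterm (a + 3 * δ) (by linarith) (by linarith)
  have h4 := hterm (a + 4 * δ) (by linarith) (by linarith)
  have h5 := hterm (a + 5 * δ) (by linarith) (by linarith)
  have h6 := hterm (a + 6 * δ) (by linarith) (by linarith)
  have hproposed := hexec.proposed_of_inTerm hB hT hleader rfl hentry hmyM h2 h3 (by linarith)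
    (by linarith) (by linarith)
  obtain ⟨M, hecho⟩ := hexec.exists_echo_sent_of_proposed (by omega) hleader rfl h3 h4
    (by linarith) hδ (by linarith) (by linarith) hproposed
  have hreadied (q) (hq : q ∉ B) := hexec.readied_of_echo_sent hB (by omega) h5 (by linarith)
    (by linarith) (by linarith) hecho hq
  exact hexec.delivered_of_readied hB h5 h6 (by linarith) (by linarith) (by linarith) hreadied hp

end IsExecution

/-! ### Infinitely many changes of leader -/

theorem frequently_ofNat_succ_eq (p : Proc f) :
    ∃ᶠ T in atTop, (Fin.ofNat (3 * f + 1) (T + 1) : Proc f) = p := by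
  refine (Nat.frequently_modEq (Nat.succ_ne_zero (3 * f)) (p + 3 * f)).mono fun T hT => ?_
  have hmod : T + 1 ≡ p [MOD 3 * f + 1] := (hT.add_right 1).trans (by simp [Nat.ModEq, add_assoc])
  exact Fin.ext (Eq.trans hmod (Nat.mod_eq_of_lt p.isLt))

namespace IsExecution

variable {timeout : ℕ → ℝ} {B : Finset (Proc f)} {p₀ : Proc f} {gst δ : ℝ}
  {cfg : ℕ → Config f V} {act : ℕ → Action f V} {time : ℕ → ℝ}
  (hexec : IsExecution timeout B p₀ gst δ cfg act time)
  {T : ℕ} {x L : ℝ}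

include hexec

theorem tendsto_entryStep (hentered : ∀ T, Entered B cfg T) :
    Tendsto (entryStep B cfg) atTop atTop := by
  refine tendsto_atTop.2 fun N => ?_
  have hlt : ∀ᶠ T in atTop, ∀ p, ((cfg N).loc p).leTs < T :=
    eventually_all.2 fun p => eventually_gt_atTop _
  filter_upwards [hlt, eventually_ge_atTop 2] with T hlt hT
  obtain ⟨p, hp, hle⟩ := hexec.exists_le_leTs_entryStep hT (hentered T)
  by_contra! hN
  exact (hle.trans (hexec.monotone_leTs hp hN)).not_gt (hlt p)

theorem tendsto_entryTime (hentered : ∀ T, Entered B cfg T) :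
    Tendsto (entryTime B cfg time) atTop atTop :=
  hexec.time_unbounded.comp (hexec.tendsto_entryStep hentered)

theorem stepsUntil_le_entryStep (h : x < entryTime B cfg time T) :
    stepsUntil time x ≤ entryStep B cfg T :=
  not_lt.1 fun hlt => (hexec.lt_stepsUntil.1 hlt).not_gt h

/-- A term lasts longer than `6 δ`, so each change of leader shrinks the lag of the slowest correct
process by `5 δ`, down to the two message delays that spreading complaints takes. -/
theorem reached_entryTime_succ (hB : B.card ≤ f) (hδ : 0 ≤ δ) (hT : 2 ≤ T)
    (hentered : Entered B cfg (T + 1)) (htimeout : 6 * δ < timeout T)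
    (hgst : gst ≤ entryTime B cfg time (T + 1))
    (hreached : Reached B (configAt cfg time (entryTime B cfg time T + L)) T) :
    Reached B (configAt cfg time (entryTime B cfg time (T + 1) + max (2 * δ) (L - 5 * δ)))
      (T + 1) := by
  set a := entryTime B cfg time T
  set b := entryTime B cfg time (T + 1)
  have hab : a + timeout T ≤ b := hexec.entryTime_add_timeout_le hB hT hentered
  have hb : 0 ≤ b := hexec.time_zero.symm.trans_le (hexec.time_mono (Nat.zero_le _))
  obtain ⟨p, hp, hle⟩ := hexec.exists_le_leTs_entryStep (by omega) hentered
  have hlt : T < ((configAt cfg time b).loc p).leTs :=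
    hle.trans (hexec.monotone_leTs hp (hexec.lt_stepsUntil.2 le_rfl))
  have hz := le_max_left (b + δ) (a + L)
  refine hexec.reached_mono (hexec.reached_succ hB hδ (z := max (b + δ) (a + L)) (by linarith)
    (by omega) hp hlt hz (by linarith) (hexec.reached_mono hreached (le_max_right _ _))) ?_
  rw [← le_sub_iff_add_le, max_le_iff]
  constructor
  · linarith [le_max_left (2 * δ) (L - 5 * δ)]
  · linarith [le_max_right (2 * δ) (L - 5 * δ)]

theorem reached_entryTime_add (hB : B.card ≤ f) (hδ : 0 ≤ δ) (hT : 2 ≤ T)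
    (hentered : ∀ T, Entered B cfg T) (htimeout : ∀ t ≥ T, 6 * δ < timeout t)
    (hgst : ∀ t ≥ T, gst ≤ entryTime B cfg time t)
    (hreached : Reached B (configAt cfg time (entryTime B cfg time T + L)) T) (n : ℕ) :
    Reached B (configAt cfg time
      (entryTime B cfg time (T + n) + max (2 * δ) (L - 5 * δ * n))) (T + n) := by
  induction n with
  | zero => exact hexec.reached_mono hreached (by simp)
  | succ n ih =>
    have hsucc := hexec.reached_entryTime_succ (T := T + n) hB hδ (by omega) (hentered _)
      (htimeout _ (by omega)) (hgst _ (by omega)) ih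
    refine hexec.reached_mono hsucc (add_le_add_right (max_le (le_max_left _ _) ?_) _)
    push_cast
    grind

theorem eventually_reached_entryTime (hB : B.card ≤ f) (hδ : 0 < δ)
    (hentered : ∀ T, Entered B cfg T) (htimeout : ∀ᶠ t in atTop, 6 * δ < timeout t) :
    ∀ᶠ T in atTop, Reached B (configAt cfg time (entryTime B cfg time T + 2 * δ)) T := by
  obtain ⟨T, hlate⟩ := eventually_atTop.1 ((eventually_ge_atTop 2).and (htimeout.and
    ((hexec.tendsto_entryTime hentered).eventually_ge_atTop gst)))
  obtain ⟨x, hx⟩ := (hexec.eventually_reached hB hδ.le (hentered T)).exists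
  obtain ⟨n, hn⟩ := exists_nat_gt ((x - entryTime B cfg time T) / (5 * δ))
  rw [div_lt_iff₀ (by positivity)] at hn
  filter_upwards [eventually_ge_atTop (T + n)] with t ht
  obtain ⟨m, rfl⟩ := Nat.exists_eq_add_of_le ht
  have hreached := hexec.reached_entryTime_add hB hδ.le (hlate T le_rfl).1 hentered
    (fun t ht => (hlate t ht).2.1) (fun t ht => (hlate t ht).2.2)
    (L := x - entryTime B cfg time T) (by rwa [add_sub_cancel]) (n + m)
  rw [add_assoc]
  refine hexec.reached_mono hreached (by
    gcongr
    refine max_le le_rfl ?_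
    push_cast
    nlinarith [(Nat.cast_nonneg m : (0 : ℝ) ≤ m)])

theorem eventually_reached_entryStep (hB : B.card ≤ f) (hδ : 0 < δ)
    (hentered : ∀ T, Entered B cfg T) (htimeout : ∀ᶠ t in atTop, 6 * δ < timeout t) :
    ∀ᶠ T in atTop, Reached B (cfg (entryStep B cfg (T + 1))) T := by
  filter_upwards [hexec.eventually_reached_entryTime hB hδ hentered htimeout, htimeout,
    eventually_ge_atTop 2] with T hreached htimeout hT p hp
  have hgap := hexec.entryTime_add_timeout_le hB hT (hentered (T + 1))
  exact (hreached p hp).trans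
    (hexec.monotone_leTs hp (hexec.stepsUntil_le_entryStep (by linarith)))

theorem exists_delivered_of_entered (hB : B.card ≤ f) (hδ : 0 < δ)
    (htimeout : ∀ᶠ t in atTop, 6 * δ < timeout t) (hbroadcast : ∀ p ∉ B, Broadcasts act p)
    (hentered : ∀ T, Entered B cfg T) :
    ∃ x, ∀ p ∉ B, ((configAt cfg time x).loc p).delivered := by
  have hmyM : ∀ᶠ n in atTop, ∀ p ∈ Bᶜ, ((cfg n).loc p).myM ≠ none :=
    Bᶜ.eventually_all.2 fun p hp =>
      have hp := Finset.mem_compl.1 hp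
      hexec.eventually_myM_ne_none hp (hbroadcast p hp)
  have hsucc := tendsto_add_atTop_nat 1
  obtain ⟨p, hp⟩ := exists_correct hB
  obtain ⟨T, rfl, hT, hmyM, htimeout, hgst, hentry, hreached⟩ :=
    ((frequently_ofNat_succ_eq p).and_eventually ((eventually_ge_atTop 2).and
      ((hsucc.eventually ((hexec.tendsto_entryStep hentered).eventually hmyM)).and
        ((hsucc.eventually htimeout).and
          ((hsucc.eventually ((hexec.tendsto_entryTime hentered).eventually_ge_atTop gst)).and
            ((hexec.eventually_reached_entryStep hB hδ hentered htimeout).and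
              (hsucc.eventually
                (hexec.eventually_reached_entryTime hB hδ hentered htimeout)))))))).exists
  exact ⟨_, fun q hq => hexec.delivered_of_correct_leader hB hδ.le hT hp hentry
    (fun r hr => hmyM r (Finset.mem_compl.2 hr)) hgst htimeout hreached hq⟩

end IsExecution

end BRD

theorem mainTheorem5 {f : ℕ} {V : Type*} (B : Finset (BRD.Proc f)) (hB : B.card ≤ f)
    (p₀ : BRD.Proc f) (gst δ : ℝ) (hδ : 0 < δ)
    (timeout : ℕ → ℝ) (htimeout_pos : ∀ t, 0 < timeout t)
    (htimeout : ∀ᶠ t in Filter.atTop, 6 * δ < timeout t)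
    (cfg : ℕ → BRD.Config f V) (act : ℕ → BRD.Action f V) (time : ℕ → ℝ)
    (hexec : BRD.IsExecution timeout B p₀ gst δ cfg act time)
    (hbroadcast : ∀ p ∉ B, BRD.Broadcasts act p) :
    ∀ p ∉ B, BRD.Delivers act p := by
  suffices h : ∃ x, ∀ p ∉ B, ((BRD.configAt cfg time x).loc p).delivered by
    obtain ⟨x, h⟩ := h
    exact fun p hp => hexec.delivers hp (h p hp)
  by_cases hentered : ∀ T, BRD.Entered B cfg T
  · exact hexec.exists_delivered_of_entered hB hδ htimeout hbroadcast hentered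
  · obtain ⟨T, hterm⟩ := hexec.exists_eventually_inTerm hB hδ.le hentered
    exact hexec.exists_delivered_of_eventually_inTerm hB hδ.le hbroadcast hterm
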